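/- **Theorem (renormalized determinants and Jost asymptotics).** Let $a_n>0$, $b_n\in\mathbb R$ ($n\ge1$) satisfy - ($\alpha$) $\sum_{n\ge1}\bigl(|a_n-1|^2+|b_n|^2\bigr)<\infty$, - ($\beta$) $\lim_{n\to\infty}a_1\cdots a_n=:P$ exists and is nonzero, - ($\gamma$) $\lim_{n\to\infty}\sum_{j=1}^n b_j$ exists. Let $J$ be the Jacobi matrix on $\ell^2(\mathbb Z_+)$ with diagonal entries $b_1,b_2,\dots$ and off-diagonal entries $a_1,a_2,\dots$; let $J_0$ be the one with $a_n\equiv1$, $b_n\equiv0$; put $\delta J=J-J_0$, and let $J^{(n)}$ be $J$ with its first $n$ rows and columns removed. Let $\mathbb D$ be the open unit disk and $\Omega=\mathbb D\setminus\{z\ne0: z+z^{-1}\in\sigma(J)\}$. For $z\in\Omega$ put $$w_n(z)=\langle\delta_n,(z+z^{-1}-J)^{-1}\delta_1\rangle\quad(n\ge1),\qquad M(z,J)=w_1(z),$$ where at $z=0$ the functions $M$ and $z^{-n}w_n$ have removable singularities and are given their limit values. For $z\in\mathbb D$ put $A(z)=\delta J\,(J_0-(z+z^{-1}))^{-1}$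 (with $A(0)=0$), $$T(z;J)=\lim_{N\to\infty}\Bigl(-\frac{z}{1-z^2}\Bigr)\Bigl[\sum_{n=1}^N b_n(1-z^{2n})+2\sum_{n=1}^N(a_n-1)(z-z^{2n+1})\Bigr],$$ $$L_{\rm ren}(z,J)=\det\nolimits_2(1+A(z))\,e^{T(z;J)},\qquad \det\nolimits_2(1+A)=\det\bigl((1+A)e^{-A}\bigr),$$ where $\det(1+B)$ for trace class $B$ is the Fredholm determinant (the limit of the determinants of the upper left $N\times N$ corners of $1+B$). Then for every $z\in\mathbb D$ these objects are well defined: $A(z)$ is Hilbert–Schmidt, $(1+A(z))e^{-A(z)}-1$ is trace class, and the limits defining its Fredholm determinant and $T(z;J)$ exist. Moreover: 1. $L_{\rm ren}(z,J)\neq0$ for all $z\in\Omega$. 2. For all $z\in\Omega$: $\displaystyle M(z,J)=\frac{z\,L_{\rm ren}(z,J^{(1)})}{L_{\rm ren}(z,J)}$. 3. For all $z\in\Omega$ and $n\ge1$: $\displaystyle z^{-n}w_n(z)=\Bigl(\prod_{j=1}^{n-1}a_j\Bigr)\frac{L_{\rm ren}(z,J^{(n)})}{L_{\rm ren}(z,J)}$.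 4. As $n\to\infty$, $z^{-n}w_n(z)\to u(z)^{-1}$ uniformly on compact subsets of $\Omega$, where $u(z)=P^{-1}L_{\rm ren}(z,J)$. -/

import Mathlib

open Filter Topology
open scoped ENNReal InnerProductSpace

/-- The Hilbert space `ℓ²(ℤ₊)` of square-summable complex sequences.  All sequences are indexed
from `0`: position `n : ℕ` stands for the index `n + 1` in the usual numbering `1, 2, 3, …`. -/
abbrev EllTwo : Type := lp (fun _ : ℕ => ℂ) 2

/-- The standard orthonormal basis vector (`δ_{n+1}` in the usual numbering). -/
noncomputable def deltaVec (n : ℕ) : EllTwo := lp.single 2 n (1 : ℂ)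

theorem inner_deltaVec (n : ℕ) (x : EllTwo) : ⟪deltaVec n, x⟫_ℂ = x n := by
  simp [deltaVec, lp.inner_single_left]

/-! ### Jacobi matrices as bounded operators -/

theorem memlp_two_of_le {x : EllTwo} {C : ℝ} {y : ℕ → ℂ} (f : ℕ → ℕ) (hf : f.Injective)
    (h : ∀ n, ‖y n‖ ≤ C * ‖x (f n)‖) : Memℓp y 2 := by
  have hx := lp.memℓp x
  rw [memℓp_gen_iff (by norm_num)] at hx ⊢
  have hx' := (hx.comp_injective hf).mul_left (C ^ 2)
  refine Summable.of_nonneg_of_le (fun n => by positivity) (fun n => ?_) hx'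
  have := pow_le_pow_left₀ (norm_nonneg _) (h n) 2
  simpa [mul_pow] using this

theorem norm_le_of_le {x y : EllTwo} {C : ℝ} (hC : 0 ≤ C) (f : ℕ → ℕ) (hf : f.Injective)
    (h : ∀ n, ‖y n‖ ≤ C * ‖x (f n)‖) : ‖y‖ ≤ C * ‖x‖ := by
  refine lp.norm_le_of_forall_sum_le (p := 2) (by norm_num) (by positivity) (fun s => ?_)
  have h1 : ∑ i ∈ s, ‖y i‖ ^ (2 : ℝ≥0∞).toReal
      ≤ C ^ 2 * ∑ i ∈ s.map ⟨f, hf⟩, ‖x i‖ ^ (2 : ℝ≥0∞).toReal := by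
    rw [Finset.sum_map, Finset.mul_sum]
    refine Finset.sum_le_sum fun n _ => ?_
    have := pow_le_pow_left₀ (norm_nonneg _) (h n) 2
    simpa [mul_pow] using this
  have h2 := lp.sum_rpow_le_norm_rpow (p := 2) (by norm_num) x (s.map ⟨f, hf⟩)
  calc _ ≤ _ := h1
    _ ≤ C ^ 2 * ‖x‖ ^ (2 : ℝ≥0∞).toReal := by gcongr
    _ = _ := by simp [mul_pow]

/-- Multiplication by the sequence `c` on `ℓ²` for a bounded sequence `c`
(and, as a default value, `0` for an unbounded one). -/
noncomputable def diagOp (c : ℕ → ℝ) : EllTwo →L[ℂ] EllTwo :=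
  open Classical in
  if h : ∃ C : ℝ, ∀ n, |c n| ≤ C then
    LinearMap.mkContinuous
      { toFun := fun x => ⟨fun n => (c n : ℂ) * x n,
          memlp_two_of_le (x := x) (C := h.choose) id Function.injective_id (fun n => by
            rw [norm_mul, Complex.norm_real]
            exact mul_le_mul_of_nonneg_right (h.choose_spec n) (norm_nonneg _))⟩
        map_add' := fun x y => by ext n; exact mul_add _ _ _
        map_smul' := fun r x => by ext n; simp [mul_left_comm] }
      h.choose
      (fun x => norm_le_of_le ((abs_nonneg _).trans (h.choose_spec 0)) id Function.injective_id
        (fun n => by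
          simp only [LinearMap.coe_mk, AddHom.coe_mk, id]
          rw [norm_mul, Complex.norm_real]
          exact mul_le_mul_of_nonneg_right (h.choose_spec n) (norm_nonneg _)))
  else 0

theorem diagOp_apply {c : ℕ → ℝ} (h : ∃ C : ℝ, ∀ n, |c n| ≤ C) (x : EllTwo) (n : ℕ) :
    diagOp c x n = (c n : ℂ) * x n := by
  rw [diagOp, dif_pos h]; rfl

/-- The backward shift `(x₀, x₁, x₂, …) ↦ (x₁, x₂, …)`. -/
noncomputable def shiftOp : EllTwo →L[ℂ] EllTwo :=
  LinearMap.mkContinuous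
    { toFun := fun x => ⟨fun n => x (n + 1),
        memlp_two_of_le (x := x) (C := 1) Nat.succ Nat.succ_injective (fun n => by simp)⟩
      map_add' := fun x y => by ext n; rfl
      map_smul' := fun r x => by ext n; simp }
    1 (fun x => norm_le_of_le zero_le_one Nat.succ Nat.succ_injective (fun n => by simp))

theorem shiftOp_apply (x : EllTwo) (n : ℕ) : shiftOp x n = x (n + 1) := rfl

/-- The forward shift `(x₀, x₁, …) ↦ (0, x₀, x₁, …)` is the adjoint of the backward shift. -/
theorem shiftOp_adjoint_apply (x : EllTwo) (n : ℕ) :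
    ContinuousLinearMap.adjoint shiftOp x n = if n = 0 then 0 else x (n - 1) := by
  rw [← inner_deltaVec, ContinuousLinearMap.adjoint_inner_right]
  cases n with
  | zero =>
    have : shiftOp (deltaVec 0) = 0 := by
      ext m; simp [shiftOp_apply, deltaVec, lp.single_apply]
    simp [this]
  | succ n =>
    have : shiftOp (deltaVec (n + 1)) = deltaVec n := by
      ext m; simp [shiftOp_apply, deltaVec, lp.single_apply, Pi.single_apply]
    simp [this, inner_deltaVec]

/-- The Jacobi matrix with diagonal `b 0, b 1, …` and off-diagonal `a 0, a 1, …`, as an operator on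
`ℓ²`; see `jacobiOp_apply`.  It is used for bounded sequences only. -/
noncomputable def jacobiOp (a b : ℕ → ℝ) : EllTwo →L[ℂ] EllTwo :=
  diagOp a * shiftOp + diagOp b + ContinuousLinearMap.adjoint shiftOp * diagOp a

theorem jacobiOp_apply {a b : ℕ → ℝ} (ha : ∃ C : ℝ, ∀ n, |a n| ≤ C) (hb : ∃ C : ℝ, ∀ n, |b n| ≤ C)
    (x : EllTwo) (n : ℕ) :
    jacobiOp a b x n = (a n : ℂ) * x (n + 1) + (b n : ℂ) * x n
      + (if n = 0 then 0 else (a (n - 1) : ℂ) * x (n - 1)) := by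
  simp [jacobiOp, diagOp_apply ha, diagOp_apply hb, shiftOp_apply, shiftOp_adjoint_apply]

/-- The free Jacobi matrix `J₀`. -/
noncomputable def freeJacobi : EllTwo →L[ℂ] EllTwo := jacobiOp (fun _ => 1) (fun _ => 0)

/-- Removal of the first `n` Jacobi parameters: `jacobiOp (strip n a) (strip n b)` is the matrix
`J^{(n)}` obtained from `J = jacobiOp a b` by removing the first `n` rows and columns. -/
def strip (n : ℕ) (c : ℕ → ℝ) : ℕ → ℝ := fun k => c (k + n)

/-! ### Weyl solution and `M`-function -/

/-- Extension of a function of `z ≠ 0` to `z = 0` by its limit there. -/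
noncomputable def extendZero (f : ℂ → ℂ) : ℂ → ℂ :=
  Function.update f 0 (limUnder (𝓝[≠] 0) f)

/-- The Weyl solution `⟨δ_{k+1}, (z + z⁻¹ - J)⁻¹ δ₁⟩` for `z ≠ 0`
(usual numbering: `w_{k+1}(z)`). -/
noncomputable def weylRaw (a b : ℕ → ℝ) (k : ℕ) (z : ℂ) : ℂ :=
  ⟪deltaVec k, Ring.inverse ((z + z⁻¹) • (1 : EllTwo →L[ℂ] EllTwo) - jacobiOp a b) (deltaVec 0)⟫_ℂ

/-- The normalized Weyl solution `z^{-(k+1)} w_{k+1}(z)`, with the removable singularity at `z = 0`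
removed. -/
noncomputable def weylNormalized (a b : ℕ → ℝ) (k : ℕ) : ℂ → ℂ :=
  extendZero fun z => (z ^ (k + 1))⁻¹ * weylRaw a b k z

/-- The `M`-function `M(z, J) = ⟨δ₁, (z + z⁻¹ - J)⁻¹ δ₁⟩`, with the removable singularity at
`z = 0` removed. -/
noncomputable def weylM (a b : ℕ → ℝ) : ℂ → ℂ := extendZero (weylRaw a b 0)

/-- The open unit disk without the points `z` for which `z + z⁻¹` is in the spectrum of `J`.
The point `z = 0` (where `z + z⁻¹ = ∞`) belongs to the set. -/
def resolventDisk (a b : ℕ → ℝ) : Set ℂ :=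
  {z | ‖z‖ < 1 ∧ (z = 0 ∨ z + z⁻¹ ∉ spectrum ℂ (jacobiOp a b))}

/-! ### Determinants -/

/-- Hilbert–Schmidt operators on `ℓ²`. -/
def IsHilbertSchmidt (A : EllTwo →L[ℂ] EllTwo) : Prop :=
  Summable fun n => ‖A (deltaVec n)‖ ^ 2

/-- Trace class operators on `ℓ²`: the products of two Hilbert–Schmidt operators. -/
def IsTraceClass (B : EllTwo →L[ℂ] EllTwo) : Prop :=
  ∃ C D : EllTwo →L[ℂ] EllTwo, IsHilbertSchmidt C ∧ IsHilbertSchmidt D ∧ B = C * D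

/-- The determinant of the `N × N` upper left corner of the matrix of `1 + B`. -/
noncomputable def sectionDet (B : EllTwo →L[ℂ] EllTwo) (N : ℕ) : ℂ :=
  (1 + Matrix.of fun i j : Fin N => ⟪deltaVec i, B (deltaVec j)⟫_ℂ).det

/-- The Fredholm determinant `det (1 + B)` of a trace class operator `B`, as the limit of
`det (1 + P_N B P_N)`, with `P_N` the orthogonal projection on the span of the first `N` vectors of
the standard basis. -/
noncomputable def fredholmDet (B : EllTwo →L[ℂ] EllTwo) : ℂ :=
  limUnder atTop (sectionDet B)

/-- The operator `(1 + A) e^{-A} - 1`, which is trace class if `A` is Hilbert–Schmidt. -/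
noncomputable def regPart (A : EllTwo →L[ℂ] EllTwo) : EllTwo →L[ℂ] EllTwo :=
  (1 + A) * NormedSpace.exp (-A) - 1

/-- The regularized determinant `det₂ (1 + A) = det ((1 + A) e^{-A})` of a Hilbert–Schmidt
operator `A`. -/
noncomputable def detTwo (A : EllTwo →L[ℂ] EllTwo) : ℂ := fredholmDet (regPart A)

/-! ### The renormalized determinant of a Jacobi matrix -/

/-- The free resolvent `(J₀ - (z + z⁻¹))⁻¹` for `0 < |z| < 1`, continued by `0` to `z = 0`. -/
noncomputable def freeResolvent (z : ℂ) : EllTwo →L[ℂ] EllTwo :=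
  if z = 0 then 0 else Ring.inverse (freeJacobi - (z + z⁻¹) • (1 : EllTwo →L[ℂ] EllTwo))

/-- The operator `δJ (J₀ - (z + z⁻¹))⁻¹` with `δJ = J - J₀`. -/
noncomputable def perturbOp (a b : ℕ → ℝ) (z : ℂ) : EllTwo →L[ℂ] EllTwo :=
  (jacobiOp a b - freeJacobi) * freeResolvent z

/-- Partial sums of the conditionally convergent trace `T(z; J)` of `perturbOp a b z`:
`-(z⁻¹ - z)⁻¹ (∑_{n ≤ N} b_n (1 - z^{2n}) + 2 ∑_{n ≤ N} (a_n - 1) (z - z^{2n+1}))` in the usual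
numbering, with `(z⁻¹ - z)⁻¹` written as `z / (1 - z²)`. -/
noncomputable def traceSum (a b : ℕ → ℝ) (z : ℂ) (N : ℕ) : ℂ :=
  -(z / (1 - z ^ 2)) *
    (∑ n ∈ Finset.range N, (b n : ℂ) * (1 - z ^ (2 * (n + 1)))
      + 2 * ∑ n ∈ Finset.range N, ((a n : ℂ) - 1) * (z - z ^ (2 * (n + 1) + 1)))

/-- The renormalized trace `T(z; J)`. -/
noncomputable def renTrace (a b : ℕ → ℝ) (z : ℂ) : ℂ := limUnder atTop (traceSum a b z)

/-- The renormalized perturbation determinant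
`L_ren(z, J) = det₂ (1 + δJ (J₀ - (z + z⁻¹))⁻¹) e^{T(z; J)}`. -/
noncomputable def renDet (a b : ℕ → ℝ) (z : ℂ) : ℂ :=
  detTwo (perturbOp a b z) * Complex.exp (renTrace a b z)

/-! Write `L_n` for the renormalized determinant of the matrix stripped of its first `n` rows and
columns. The theorem is reduced to two facts about these numbers at fixed `z` in the disk: the
recurrence `L_n = (1 + z² - z b_n) L_{n+1} - z² a_n² L_{n+2}` (`Admissible.renDet_rec`) and the
limit `L_n → 1`, locally uniformly in `z` (`Admissible.tendsto_renDet_strip`).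

By the recurrence, `x_k = z^{k+1} a_0 ⋯ a_{k-1} L_{k+1}` satisfies `(z + z⁻¹ - J) x = L_0 δ_0`, and
`x` is square summable because `L_n` and the products are bounded
(`Admissible.exists_jostSolution`). Off the spectrum, `L_0 = 0` would force `x = 0`, hence `L_n = 0`
for all `n ≥ 1`, against `L_n → 1`. Thus `L_0 ≠ 0`, and dividing by it gives the resolvent entries,
in particular `M`. The asymptotics follow from `L_n → 1` and `a_0 ⋯ a_{n-1} → P`.

Both facts come from finite sections. For matrices, `det (1 + M) e^{-tr M}` is bounded and locally
Lipschitz in the Frobenius norm, with constants free of the dimension. Hence its values on the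
corners of a Hilbert–Schmidt `A` converge; the limit is `det₂ (1 + A)`
(`HSBound.tendsto_matDetTwo_corner`) and inherits the Lipschitz bound, which yields continuity in
`z` and `L_n → 1`. The traces of the corners of `δJ (J₀ - z - z⁻¹)⁻¹` differ from the partial sums
of `T` by a vanishing boundary term, so the plain section determinants converge to `L_ren`
(`Admissible.tendsto_jostDet`). They equal explicit tridiagonal determinants, whose Laplace
expansion becomes the recurrence in the limit. -/

/-! ### Regularized determinants of matrices -/

section MatrixDet

open Matrix
open scoped Matrix.Norms.Frobenius ComplexOrder

variable {n : Type*} [Fintype n] [DecidableEq n]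

/-- The regularized determinant `det (1 + M) e^{- tr M}` of a matrix. -/
noncomputable def matDetTwo (M : Matrix n n ℂ) : ℂ := (1 + M).det * Complex.exp (-M.trace)

theorem frobenius_sq (M : Matrix n n ℂ) : ‖M‖ ^ 2 = ∑ i, ∑ j, ‖M i j‖ ^ 2 := by
  rw [frobenius_norm_def, ← Real.sqrt_eq_rpow, Real.sq_sqrt (by positivity)]
  simp

theorem trace_conjTranspose_mul_self_eq (M : Matrix n n ℂ) :
    (Mᴴ * M).trace = ((‖M‖ ^ 2 : ℝ) : ℂ) := by
  rw [frobenius_sq, Finset.sum_comm]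
  simp [Matrix.trace, Matrix.mul_apply, ← Complex.normSq_eq_conj_mul_self, Complex.normSq_eq_norm_sq]

/-- The eigenvalues of `Mᴴ * M` are nonnegative, have product `‖M.det‖ ^ 2` and sum `‖M‖ ^ 2`; the
inequality `t ≤ e^{t-1}` is applied to each of them. -/
theorem normSq_det_le (M : Matrix n n ℂ) :
    ‖M.det‖ ^ 2 ≤ Real.exp (‖M‖ ^ 2 - Fintype.card n) := by
  have hpos := Matrix.posSemidef_conjTranspose_mul_self M
  have hdet : ((‖M.det‖ ^ 2 : ℝ) : ℂ) = ∏ i, (hpos.isHermitian.eigenvalues i : ℂ) := by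
    rw [← RCLike.ofReal_eq_complex_ofReal, ← hpos.isHermitian.det_eq_prod_eigenvalues, det_mul, det_conjTranspose]
    simp [← Complex.normSq_eq_conj_mul_self, Complex.normSq_eq_norm_sq]
  have htr : ‖M‖ ^ 2 = ∑ i, hpos.isHermitian.eigenvalues i := by
    have := hpos.isHermitian.trace_eq_sum_eigenvalues
    rw [trace_conjTranspose_mul_self_eq] at this
    refine Complex.ofReal_injective (this.trans ?_)
    simp
  have hdet' : ‖M.det‖ ^ 2 = ∏ i, hpos.isHermitian.eigenvalues i := by exact_mod_cast hdet
  rw [hdet', htr]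
  have : (∑ i, hpos.isHermitian.eigenvalues i) - Fintype.card n
      = ∑ i, (hpos.isHermitian.eigenvalues i - 1) := by simp
  rw [this, Real.exp_sum]
  refine Finset.prod_le_prod (fun i _ => hpos.eigenvalues_nonneg i) (fun i _ => ?_)
  linarith [Real.add_one_le_exp (hpos.isHermitian.eigenvalues i - 1)]

theorem frobenius_sq_one_add (M : Matrix n n ℂ) :
    ‖1 + M‖ ^ 2 = Fintype.card n + 2 * M.trace.re + ‖M‖ ^ 2 := by
  have h1 := trace_conjTranspose_mul_self_eq (1 + M)
  have h2 : ((1 + M)ᴴ * (1 + M)).trace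
      = Fintype.card n + (M.trace + star M.trace) + ((‖M‖ ^ 2 : ℝ) : ℂ) := by
    rw [← trace_conjTranspose_mul_self_eq, conjTranspose_add, conjTranspose_one, add_mul, mul_add,
      one_mul, mul_add, mul_one, one_mul, trace_add, trace_add, trace_add, trace_one, trace_conjTranspose]
    ring
  rw [h1] at h2
  have := congrArg Complex.re h2
  simp only [Complex.ofReal_re, Complex.add_re, Complex.natCast_re, Complex.star_def,
    Complex.conj_re] at this
  linarith

/-- Expanding `‖1 + M‖ ^ 2` cancels the dimension in `normSq_det_le`, and the factor `e^{-tr M}`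
cancels the trace, so the bound survives the passage to infinite dimension. -/
theorem norm_matDetTwo_le (M : Matrix n n ℂ) : ‖matDetTwo M‖ ≤ Real.exp (‖M‖ ^ 2 / 2) := by
  have h1 := normSq_det_le (1 + M)
  rw [frobenius_sq_one_add] at h1
  refine le_of_sq_le_sq ?_ (Real.exp_pos _).le
  rw [matDetTwo, norm_mul, mul_pow, Complex.norm_exp, ← Real.exp_nat_mul, ← Real.exp_nat_mul]
  refine (mul_le_mul_of_nonneg_right h1 (Real.exp_pos _).le).trans (le_of_eq ?_)
  rw [← Real.exp_add]
  congr 1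
  push_cast
  simp
  ring

theorem differentiable_matDetTwo_line (M D : Matrix n n ℂ) :
    Differentiable ℂ fun t : ℂ => matDetTwo (M + t • D) := by
  unfold matDetTwo
  simp only [det_apply, Matrix.trace, Matrix.diag, Matrix.add_apply, Matrix.smul_apply]
  fun_prop

/-- The function is entire along the complex line through `M'` and `M`, so Cauchy's estimate turns
the growth bound into a bound on the derivative over the segment. -/
theorem norm_matDetTwo_sub_le {M M' : Matrix n n ℂ} {c ε : ℝ} (hM : ‖M‖ ≤ c) (hM' : ‖M'‖ ≤ c)
    (hε : ‖M - M'‖ ≤ ε) :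
    ‖matDetTwo M - matDetTwo M'‖ ≤ ε * Real.exp ((c + 1) ^ 2 / 2) := by
  rcases eq_or_ne M M' with rfl | hne
  · have : 0 ≤ ε := (norm_nonneg _).trans hε
    simp only [sub_self, norm_zero]; positivity
  have hd : 0 < ‖M - M'‖ := norm_pos_iff.2 (sub_ne_zero.2 hne)
  have hc : 0 ≤ c := (norm_nonneg _).trans hM
  set f : ℂ → ℂ := fun t => matDetTwo (M' + t • (M - M')) with hf
  have hdf : Differentiable ℂ f := differentiable_matDetTwo_line _ _
  -- On a circle of radius `‖M - M'‖⁻¹` the matrix moves by exactly `1` in norm, whence `c + 1` in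
  -- the exponent.
  have hder : ∀ t ∈ segment ℝ (0 : ℂ) 1, ‖deriv f t‖ ≤
      Real.exp ((c + 1) ^ 2 / 2) / ‖M - M'‖⁻¹ := by
    rintro t ⟨p, q, hp, hq, hpq, rfl⟩
    refine Complex.norm_deriv_le_of_forall_mem_sphere_norm_le (inv_pos.2 hd)
      hdf.diffContOnCl (fun s hs => ?_)
    refine (norm_matDetTwo_le _).trans (Real.exp_le_exp.2 ?_)
    gcongr
    have : M' + s • (M - M') = ((p : ℂ) • M' + (q : ℂ) • M)
        + (s - (p • (0 : ℂ) + q • (1 : ℂ))) • (M - M') := by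
      have : (p : ℂ) = 1 - q := by
        rw [eq_sub_iff_add_eq]; exact_mod_cast hpq
      rw [this]
      simp only [smul_zero, zero_add, Complex.real_smul, mul_one]
      module
    rw [this]
    refine (norm_add_le _ _).trans (add_le_add ((norm_add_le _ _).trans ?_) ?_)
    · rw [norm_smul, norm_smul, Complex.norm_real, Complex.norm_real, Real.norm_of_nonneg hp,
        Real.norm_of_nonneg hq]
      nlinarith
    · rw [norm_smul]
      rw [mem_sphere_iff_norm] at hs
      rw [hs, inv_mul_cancel₀ hd.ne']
  have := (convex_segment (0 : ℂ) 1).norm_image_sub_le_of_norm_deriv_le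
    (fun x _ => hdf x) hder (left_mem_segment _ _ _) (right_mem_segment _ _ _)
  simp only [hf, one_smul, zero_smul, add_zero, sub_zero, norm_one, mul_one,
    add_sub_cancel, div_inv_eq_mul] at this
  refine this.trans ?_
  rw [mul_comm]
  gcongr

theorem matDetTwo_zero : matDetTwo (0 : Matrix n n ℂ) = 1 := by simp [matDetTwo]

/-! ### Determinant of a matrix exponential. -/

theorem hasDerivAt_det_one_add_smul (M : Matrix n n ℂ) :
    HasDerivAt (fun t : ℂ => (1 + t • M).det) M.trace 0 := by
  have h0 : (fun t : ℂ => (1 + t • M).det) = _ := funext fun t => det_one_add_smul t M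
  rw [h0]
  have h : HasDerivAt (fun t : ℂ => 1 + M.trace * t
      + (Polynomial.eval t (det (1 + (Polynomial.X : Polynomial ℂ) • M.map Polynomial.C)).divX.divX)
        * t ^ 2) (0 + M.trace * 1 + _) 0 :=
    (((hasDerivAt_const _ _).add ((hasDerivAt_id (0 : ℂ)).const_mul _)).add
      (((Polynomial.hasDerivAt _ _)).mul (hasDerivAt_pow 2 (0 : ℂ))))
  simpa using h

theorem differentiable_det : Differentiable ℂ (fun M : Matrix n n ℂ => M.det) := by
  simp only [det_apply]
  have h : ∀ i j : n, Differentiable ℂ fun M : Matrix n n ℂ => M i j := fun i j =>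
    (LinearMap.toContinuousLinearMap (Matrix.entryLinearMap ℂ ℂ i j)).differentiable
  fun_prop

/-- The function `t ↦ det e^{tM}` is multiplicative with derivative `tr M` at `0`; hence its product
with `e^{-t tr M}` has zero derivative everywhere. -/
theorem det_exp_eq (M : Matrix n n ℂ) : (NormedSpace.exp M).det = Complex.exp M.trace := by
  set f : ℂ → ℂ := fun t => (NormedSpace.exp (t • M)).det with hf
  have h0 : HasDerivAt f M.trace 0 := by
    have hexp := hasDerivAt_exp_smul_const (𝕂 := ℂ) M (0 : ℂ)
    have h1 : HasDerivAt (fun t : ℂ => (1 : Matrix n n ℂ) + t • M) ((1 : ℂ) • M) 0 :=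
      ((hasDerivAt_id (0 : ℂ)).smul_const M).const_add 1
    rw [zero_smul, NormedSpace.exp_zero, one_mul] at hexp
    rw [one_smul] at h1
    have e1 := HasFDerivAt.comp_hasDerivAt (0 : ℂ)
      (differentiable_det (n := n) (1 + (0 : ℂ) • M)).hasFDerivAt h1
    have e2 := HasFDerivAt.comp_hasDerivAt (0 : ℂ)
      (differentiable_det (n := n) (NormedSpace.exp ((0 : ℂ) • M))).hasFDerivAt hexp
    have e3 := e1.unique (hasDerivAt_det_one_add_smul M)
    rw [zero_smul, add_zero] at e3
    rw [zero_smul, NormedSpace.exp_zero, e3] at e2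
    exact e2
  have hadd : ∀ s t, f (s + t) = f s * f t := fun s t => by
    simp only [hf, add_smul]
    rw [Matrix.exp_add_of_commute _ _ ((Commute.refl M).smul_left s |>.smul_right t), det_mul]
  have hder : ∀ t, HasDerivAt f (f t * M.trace) t := fun t => by
    have h1 : HasDerivAt (fun s => f t * f (s - t)) (f t * M.trace) t := by
      refine HasDerivAt.const_mul _ ?_
      exact HasDerivAt.comp_sub_const t t (by simpa using h0)
    refine h1.congr_of_eventuallyEq (Eventually.of_forall fun s => ?_)
    change f s = f t * f (s - t)
    rw [← hadd, add_sub_cancel]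
  have hconst : ∀ t, HasDerivAt (fun t => f t * Complex.exp (-(t * M.trace))) 0 t := fun t => by
    have h2 : HasDerivAt (fun t : ℂ => Complex.exp (-(t * M.trace))) _ t :=
      (((hasDerivAt_id t).mul_const M.trace).neg).cexp
    have := (hder t).mul h2
    refine this.congr_deriv ?_
    simp only [Pi.neg_apply, id]
    ring
  have := is_const_of_deriv_eq_zero (fun t => (hconst t).differentiableAt)
    (fun t => (hconst t).deriv) 1 0
  simp only [hf, one_smul, zero_smul, NormedSpace.exp_zero, det_one, one_mul, zero_mul, neg_zero,
    Complex.exp_zero] at this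
  rw [Complex.exp_neg] at this
  exact (mul_inv_eq_one₀ (Complex.exp_ne_zero _)).1 this

end MatrixDet

/-! ### Hilbert–Schmidt bounds -/

theorem hasSum_norm_sq (x : EllTwo) : HasSum (fun i => ‖x i‖ ^ 2) (‖x‖ ^ 2) := by
  simpa using lp.hasSum_norm (p := 2) (by norm_num) x

theorem sum_norm_sq_le (x : EllTwo) (s : Finset ℕ) : ∑ i ∈ s, ‖x i‖ ^ 2 ≤ ‖x‖ ^ 2 :=
  sum_le_hasSum s (fun _ _ => by positivity) (hasSum_norm_sq x)

theorem norm_sq_le_of_sum_le {x : EllTwo} {c : ℝ} (h : ∀ s : Finset ℕ, ∑ i ∈ s, ‖x i‖ ^ 2 ≤ c) :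
    ‖x‖ ^ 2 ≤ c :=
  hasSum_le_of_sum_le (hasSum_norm_sq x) h

theorem norm_deltaVec (n : ℕ) : ‖deltaVec n‖ = 1 := by
  simp [deltaVec, lp.norm_single]

theorem deltaVec_apply (n m : ℕ) : deltaVec n m = if m = n then 1 else 0 := by
  simp [deltaVec, lp.single_apply, Pi.single_apply]

theorem ext_deltaVec {A B : EllTwo →L[ℂ] EllTwo} (h : ∀ n, A (deltaVec n) = B (deltaVec n)) :
    A = B := by
  refine ContinuousLinearMap.ext fun x => ?_
  have hx := lp.hasSum_single (p := 2) (by norm_num) x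
  have h1 := hx.mapL A
  have h2 := hx.mapL B
  have : ∀ n, lp.single 2 n (x n) = x n • deltaVec n := fun n => by
    rw [deltaVec, ← lp.single_smul]; simp
  simp only [this, map_smul, h] at h1 h2
  exact h1.unique h2

theorem adjoint_deltaVec_apply (A : EllTwo →L[ℂ] EllTwo) (i j : ℕ) :
    ContinuousLinearMap.adjoint A (deltaVec i) j = star (A (deltaVec j) i) := by
  rw [← inner_deltaVec, ContinuousLinearMap.adjoint_inner_right, ← inner_conj_symm, inner_deltaVec]
  rfl

/-- `c` is an upper bound for the Hilbert–Schmidt norm of `A`. -/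
def HSBound (A : EllTwo →L[ℂ] EllTwo) (c : ℝ) : Prop :=
  0 ≤ c ∧ ∀ s : Finset ℕ, ∑ j ∈ s, ‖A (deltaVec j)‖ ^ 2 ≤ c ^ 2

namespace HSBound

variable {A B : EllTwo →L[ℂ] EllTwo} {c d : ℝ}

theorem isHilbertSchmidt (h : HSBound A c) : IsHilbertSchmidt A :=
  summable_of_sum_le (fun _ => by positivity) h.2

theorem mono (h : HSBound A c) (hcd : c ≤ d) : HSBound A d :=
  ⟨h.1.trans hcd, fun s => (h.2 s).trans (pow_le_pow_left₀ h.1 hcd 2)⟩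

theorem of_forall_norm_le (h : HSBound A c) (hAB : ∀ n, ‖B (deltaVec n)‖ ≤ ‖A (deltaVec n)‖) :
    HSBound B c :=
  ⟨h.1, fun s => (Finset.sum_le_sum fun _ _ =>
    pow_le_pow_left₀ (norm_nonneg _) (hAB _) 2).trans (h.2 s)⟩

theorem neg (h : HSBound A c) : HSBound (-A) c := h.of_forall_norm_le fun n => by simp

theorem smul (h : HSBound A c) (r : ℂ) : HSBound (r • A) (‖r‖ * c) := by
  refine ⟨mul_nonneg (norm_nonneg _) h.1, fun s => ?_⟩
  simp only [smul_apply, norm_smul, mul_pow, ← Finset.mul_sum]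
  exact mul_le_mul_of_nonneg_left (h.2 s) (by positivity)

theorem add (hA : HSBound A c) (hB : HSBound B d) : HSBound (A + B) (c + d) := by
  refine ⟨add_nonneg hA.1 hB.1, fun s => ?_⟩
  have h1 : ∑ j ∈ s, ‖(A + B) (deltaVec j)‖ ^ 2
      ≤ ∑ j ∈ s, (‖A (deltaVec j)‖ + ‖B (deltaVec j)‖) ^ 2 :=
    Finset.sum_le_sum fun j _ => pow_le_pow_left₀ (norm_nonneg _) (norm_add_le _ _) 2
  have h2 : ∑ j ∈ s, ‖A (deltaVec j)‖ * ‖B (deltaVec j)‖ ≤ c * d := by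
    refine abs_le_of_sq_le_sq' ?_ (mul_nonneg hA.1 hB.1) |>.2
    refine (Finset.sum_mul_sq_le_sq_mul_sq s _ _).trans ?_
    rw [mul_pow]
    exact mul_le_mul (hA.2 s) (hB.2 s) (by positivity) (by positivity)
  have h3 : ∑ j ∈ s, (‖A (deltaVec j)‖ + ‖B (deltaVec j)‖) ^ 2 = ∑ j ∈ s, ‖A (deltaVec j)‖ ^ 2
      + 2 * ∑ j ∈ s, ‖A (deltaVec j)‖ * ‖B (deltaVec j)‖ + ∑ j ∈ s, ‖B (deltaVec j)‖ ^ 2 := by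
    rw [Finset.mul_sum, ← Finset.sum_add_distrib, ← Finset.sum_add_distrib]
    exact Finset.sum_congr rfl fun j _ => by ring
  nlinarith [hA.2 s, hB.2 s]

theorem sub (hA : HSBound A c) (hB : HSBound B d) : HSBound (A - B) (c + d) := by
  rw [sub_eq_add_neg]; exact hA.add hB.neg

/-- The sum of the squared moduli of all matrix entries may be taken by rows or by columns. -/
theorem adjoint (h : HSBound A c) : HSBound (ContinuousLinearMap.adjoint A) c := by
  refine ⟨h.1, fun s => ?_⟩
  refine hasSum_le_of_sum_le (hasSum_sum fun i (_ : i ∈ s) =>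
    hasSum_norm_sq (ContinuousLinearMap.adjoint A (deltaVec i))) fun t => ?_
  refine le_trans (Finset.sum_le_sum fun j _ => ?_) (h.2 t)
  simp only [adjoint_deltaVec_apply, norm_star]
  exact sum_norm_sq_le _ _

theorem of_adjoint (h : HSBound (ContinuousLinearMap.adjoint A) c) : HSBound A c := by
  simpa using h.adjoint

theorem mul_left (h : HSBound A c) (B : EllTwo →L[ℂ] EllTwo) : HSBound (B * A) (‖B‖ * c) := by
  refine ⟨mul_nonneg (norm_nonneg _) h.1, fun s => ?_⟩
  rw [mul_pow]
  refine le_trans ?_ (mul_le_mul_of_nonneg_left (h.2 s) (by positivity))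
  rw [Finset.mul_sum]
  refine Finset.sum_le_sum fun j _ => ?_
  rw [← mul_pow]
  exact pow_le_pow_left₀ (norm_nonneg _) (B.le_opNorm _) 2

theorem mul_right (h : HSBound A c) (B : EllTwo →L[ℂ] EllTwo) : HSBound (A * B) (c * ‖B‖) := by
  apply of_adjoint
  have := h.adjoint.mul_left (ContinuousLinearMap.adjoint B)
  rw [LinearIsometryEquiv.norm_map, mul_comm] at this
  rwa [ContinuousLinearMap.mul_def, ContinuousLinearMap.adjoint_comp]

theorem norm_le (h : HSBound A c) : ‖A‖ ≤ c := by
  refine ContinuousLinearMap.opNorm_le_bound _ h.1 fun x => ?_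
  refine le_of_sq_le_sq (norm_sq_le_of_sum_le fun s => ?_) (mul_nonneg h.1 (norm_nonneg _))
  rw [mul_pow]
  refine le_trans ?_ (mul_le_mul_of_nonneg_right (h.adjoint.2 s) (by positivity))
  rw [Finset.sum_mul]
  refine Finset.sum_le_sum fun i _ => ?_
  rw [← mul_pow, ← inner_deltaVec, ← ContinuousLinearMap.adjoint_inner_left]
  exact pow_le_pow_left₀ (norm_nonneg _) (norm_inner_le_norm _ _) 2

theorem mul (hA : HSBound A c) (hB : HSBound B d) : HSBound (A * B) (c * d) :=
  (hB.mul_left A).mono (mul_le_mul_of_nonneg_right hA.norm_le hB.1)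

/-- Cauchy–Schwarz is used in `ℓ²` for each diagonal entry and then in the sum over `i`. -/
theorem sum_diag_mul_le (hA : HSBound A c) (hB : HSBound B d) (s : Finset ℕ) :
    ∑ i ∈ s, ‖⟪deltaVec i, (A * B) (deltaVec i)⟫_ℂ‖ ≤ c * d := by
  have h1 : ∑ i ∈ s, ‖⟪deltaVec i, (A * B) (deltaVec i)⟫_ℂ‖
      ≤ ∑ i ∈ s, ‖ContinuousLinearMap.adjoint A (deltaVec i)‖ * ‖B (deltaVec i)‖ := by
    refine Finset.sum_le_sum fun i _ => ?_
    rw [mul_apply_eq_comp, ← ContinuousLinearMap.adjoint_inner_left]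
    exact norm_inner_le_norm _ _
  refine h1.trans (abs_le_of_sq_le_sq' ?_ (mul_nonneg hA.1 hB.1) |>.2)
  refine (Finset.sum_mul_sq_le_sq_mul_sq s _ _).trans ?_
  rw [mul_pow]
  exact mul_le_mul (hA.adjoint.2 s) (hB.2 s) (by positivity) (by positivity)

end HSBound

/-! ### Truncations -/

/-- The orthogonal projection on the span of the first `N` basis vectors. -/
noncomputable def truncProj (N : ℕ) : EllTwo →L[ℂ] EllTwo := diagOp fun n => if n < N then 1 else 0

theorem truncProj_apply (N : ℕ) (x : EllTwo) (n : ℕ) :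
    truncProj N x n = if n < N then x n else 0 := by
  rw [truncProj, diagOp_apply ⟨1, fun n => by split_ifs <;> simp⟩]
  split_ifs <;> simp

theorem truncProj_deltaVec (N n : ℕ) :
    truncProj N (deltaVec n) = if n < N then deltaVec n else 0 := by
  ext m
  rw [truncProj_apply, deltaVec_apply]
  rcases eq_or_ne m n with rfl | h
  · by_cases h : m < N <;> simp [h, deltaVec_apply]
  · split_ifs <;> simp [deltaVec_apply, h]

theorem truncProj_mul_self (N : ℕ) : truncProj N * truncProj N = truncProj N := by
  ext x n
  simp only [mul_apply_eq_comp, truncProj_apply]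
  split_ifs <;> rfl

theorem adjoint_truncProj (N : ℕ) : ContinuousLinearMap.adjoint (truncProj N) = truncProj N := by
  refine ext_deltaVec fun n => ?_
  ext m
  rw [adjoint_deltaVec_apply, truncProj_apply, truncProj_apply, deltaVec_apply, deltaVec_apply]
  rcases eq_or_ne m n with rfl | h
  · split_ifs <;> simp
  · simp [h, h.symm]

theorem norm_truncProj_le (N : ℕ) : ‖truncProj N‖ ≤ 1 := by
  refine ContinuousLinearMap.opNorm_le_bound _ zero_le_one fun x => ?_
  refine norm_le_of_le zero_le_one id Function.injective_id fun n => ?_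
  rw [truncProj_apply]
  split_ifs <;> simp

theorem truncProj_eq_sum (N : ℕ) (x : EllTwo) :
    truncProj N x = ∑ k : Fin N, x k • deltaVec k := by
  ext n
  rw [truncProj_apply, lp.coeFn_sum, Finset.sum_apply]
  simp only [lp.coeFn_smul, Pi.smul_apply, deltaVec_apply, smul_eq_mul, mul_ite, mul_one, mul_zero]
  rw [Fin.sum_univ_eq_sum_range (fun k => if n = k then x k else 0)]
  simp

/-- The truncation `P_N A P_N`. -/
noncomputable def trunc (N : ℕ) (A : EllTwo →L[ℂ] EllTwo) : EllTwo →L[ℂ] EllTwo :=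
  truncProj N * A * truncProj N

theorem trunc_mul_truncProj (N : ℕ) (A : EllTwo →L[ℂ] EllTwo) :
    trunc N A * truncProj N = trunc N A := by
  simp only [trunc, mul_assoc, truncProj_mul_self]

theorem trunc_deltaVec_apply (N : ℕ) (A : EllTwo →L[ℂ] EllTwo) (i j : ℕ) :
    trunc N A (deltaVec j) i = if i < N ∧ j < N then A (deltaVec j) i else 0 := by
  simp only [trunc, mul_apply_eq_comp, truncProj_apply, truncProj_deltaVec]
  split_ifs <;> simp_all

theorem HSBound.trunc {A : EllTwo →L[ℂ] EllTwo} {c : ℝ} (h : HSBound A c) (N : ℕ) :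
    HSBound (trunc N A) c := by
  refine ((h.mul_left (truncProj N)).mul_right (truncProj N)).mono ?_
  have := norm_truncProj_le N
  have h0 := norm_nonneg (truncProj N)
  have h1 := h.1
  calc ‖truncProj N‖ * c * ‖truncProj N‖ ≤ 1 * c * 1 := by gcongr
    _ = c := by ring

theorem HSBound.eventually_mul_one_sub_truncProj {A : EllTwo →L[ℂ] EllTwo} {c : ℝ}
    (h : HSBound A c) {ε : ℝ} (hε : 0 < ε) :
    ∀ᶠ N in atTop, HSBound (A * (1 - truncProj N)) ε := by
  obtain ⟨s₀, hs₀⟩ := summable_iff_vanishing_norm.1 h.isHilbertSchmidt (ε ^ 2) (by positivity)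
  filter_upwards [eventually_gt_atTop (s₀.sup id)] with N hN
  refine ⟨hε.le, fun s => ?_⟩
  have h1 : ∀ j, ‖(A * (1 - truncProj N)) (deltaVec j)‖ ^ 2
      = if j < N then 0 else ‖A (deltaVec j)‖ ^ 2 := fun j => by
    simp only [mul_apply_eq_comp, sub_apply,
      one_apply_eq_self, truncProj_deltaVec]
    split_ifs <;> simp
  have h2 := hs₀ (s.filter fun j => ¬ j < N) (by
    rw [Finset.disjoint_left]
    intro j hj hj'
    have := Finset.le_sup (f := id) hj'
    simp only [id, Finset.mem_filter] at this hj
    omega)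
  simp only [h1]
  refine le_trans ?_ ((Real.le_norm_self _).trans h2.le)
  rw [Finset.sum_filter]
  refine Finset.sum_le_sum fun j _ => ?_
  split_ifs <;> simp

/-- The discarded columns form a tail of a convergent series; the discarded rows are columns of the
adjoint. -/
theorem HSBound.eventually_sub_trunc {A : EllTwo →L[ℂ] EllTwo} {c : ℝ} (h : HSBound A c)
    {ε : ℝ} (hε : 0 < ε) : ∀ᶠ N in atTop, HSBound (A - _root_.trunc N A) ε := by
  filter_upwards [h.eventually_mul_one_sub_truncProj (half_pos hε),
    h.adjoint.eventually_mul_one_sub_truncProj (half_pos hε)] with N h1 h2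
  have h3 : HSBound ((1 - truncProj N) * A) (ε / 2) := by
    apply HSBound.of_adjoint
    rwa [ContinuousLinearMap.mul_def, ContinuousLinearMap.adjoint_comp, map_sub,
      adjoint_truncProj, ContinuousLinearMap.one_def, ContinuousLinearMap.adjoint_id]
  have h4 := h1.add (h3.mul_right (truncProj N))
  have h5 : A - _root_.trunc N A
      = A * (1 - truncProj N) + (1 - truncProj N) * A * truncProj N := by
    simp only [_root_.trunc]; noncomm_ring
  rw [h5]
  refine h4.mono ?_
  nlinarith [norm_truncProj_le N]

/-! ### Sections -/

/-- The upper left `N × N` corner of the matrix of an operator. -/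
noncomputable def corner (N : ℕ) : (EllTwo →L[ℂ] EllTwo) →ₗ[ℂ] Matrix (Fin N) (Fin N) ℂ where
  toFun A := Matrix.of fun i j => ⟪deltaVec i, A (deltaVec j)⟫_ℂ
  map_add' A B := by ext i j; simp
  map_smul' r A := by ext i j; simp

theorem corner_apply (N : ℕ) (A : EllTwo →L[ℂ] EllTwo) (i j : Fin N) :
    corner N A i j = A (deltaVec j) i := inner_deltaVec _ _

theorem sectionDet_eq (B : EllTwo →L[ℂ] EllTwo) (N : ℕ) :
    sectionDet B N = (1 + corner N B).det := rfl

theorem continuous_corner (N : ℕ) : Continuous (corner N) := by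
  refine continuous_matrix fun i j => ?_
  change Continuous fun A : EllTwo →L[ℂ] EllTwo => ⟪deltaVec i, A (deltaVec j)⟫_ℂ
  fun_prop

theorem corner_one (N : ℕ) : corner N 1 = 1 := by
  ext i j
  rw [corner_apply, one_apply_eq_self, deltaVec_apply, Matrix.one_apply]
  simp [Fin.ext_iff]

/-- Taking corners is multiplicative only with the projection in between; for truncated operators
the projection can be inserted freely. -/
theorem corner_mul_truncProj_mul (N : ℕ) (A B : EllTwo →L[ℂ] EllTwo) :
    corner N (A * truncProj N * B) = corner N A * corner N B := by
  ext i j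
  rw [corner_apply, mul_apply_eq_comp, mul_apply_eq_comp, truncProj_eq_sum, map_sum,
    lp.coeFn_sum, Finset.sum_apply, Matrix.mul_apply]
  refine Finset.sum_congr rfl fun k _ => ?_
  rw [corner_apply, corner_apply, map_smul, lp.coeFn_smul, Pi.smul_apply, smul_eq_mul, mul_comm]

theorem corner_trunc (N : ℕ) (A : EllTwo →L[ℂ] EllTwo) : corner N (trunc N A) = corner N A := by
  ext i j
  rw [corner_apply, corner_apply, trunc_deltaVec_apply, if_pos ⟨i.2, j.2⟩]

theorem corner_pow_of_mul_truncProj {N : ℕ} {A : EllTwo →L[ℂ] EllTwo} (h : A * truncProj N = A)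
    (k : ℕ) : corner N (A ^ k) = corner N A ^ k := by
  induction k with
  | zero => simp [corner_one]
  | succ k ih => rw [pow_succ', pow_succ', ← ih, ← corner_mul_truncProj_mul, h]

theorem corner_exp_of_mul_truncProj {N : ℕ} {A : EllTwo →L[ℂ] EllTwo} (h : A * truncProj N = A) :
    corner N (NormedSpace.exp A) = NormedSpace.exp (corner N A) := by
  have h1 := (NormedSpace.exp_series_hasSum_exp' (𝕂 := ℂ) A).map (corner N) (continuous_corner N)
  rw [NormedSpace.exp_eq_tsum ℂ (𝔸 := Matrix (Fin N) (Fin N) ℂ), ← h1.tsum_eq]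
  refine tsum_congr fun k => ?_
  simp only [Function.comp_apply, map_smul, corner_pow_of_mul_truncProj h]

open scoped Matrix.Norms.Frobenius in
theorem HSBound.norm_corner_le {A : EllTwo →L[ℂ] EllTwo} {c : ℝ} (h : HSBound A c) (N : ℕ) :
    ‖corner N A‖ ≤ c := by
  refine le_of_sq_le_sq ?_ h.1
  rw [frobenius_sq, Finset.sum_comm]
  simp only [corner_apply]
  rw [Fin.sum_univ_eq_sum_range (fun j => ∑ i : Fin N, ‖A (deltaVec j) i‖ ^ 2) N]
  refine le_trans (Finset.sum_le_sum fun j _ => ?_) (h.2 (Finset.range N))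
  rw [Fin.sum_univ_eq_sum_range (fun i => ‖A (deltaVec j) i‖ ^ 2) N]
  exact sum_norm_sq_le _ _

/-- The regularized determinant of the truncation is independent of the size of the corner. -/
theorem matDetTwo_corner_trunc {N M : ℕ} (hNM : N ≤ M) (A : EllTwo →L[ℂ] EllTwo) :
    matDetTwo (corner M (trunc N A)) = matDetTwo (corner N A) := by
  -- `ι` is the inclusion of `ℂ^N` in `ℂ^M`. The larger corner is `ι X ιᵀ` with `ιᵀ ι = 1`, and `det
  -- (1 + UV) = det (1 + VU)` moves `ι` around.
  set ι : Matrix (Fin M) (Fin N) ℂ := Matrix.of fun i j => if (i : ℕ) = j then 1 else 0 with hι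
  have h1 : corner M (trunc N A) = ι * (corner N A * ι.transpose) := by
    ext i j
    rw [corner_apply, trunc_deltaVec_apply]
    simp only [hι, Matrix.mul_apply, Matrix.of_apply, Matrix.transpose_apply, ite_mul, one_mul,
      zero_mul, mul_ite, mul_one, mul_zero]
    split_ifs with h
    · rw [Finset.sum_eq_single ⟨i, h.1⟩, if_pos rfl, Finset.sum_eq_single ⟨j, h.2⟩, if_pos rfl,
        corner_apply]
      · intro k _ hk
        rw [if_neg fun h' => hk (Fin.ext h'.symm)]
      · simp
      · intro k _ hk
        rw [if_neg fun h' => hk (Fin.ext h'.symm)]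
      · simp
    · symm
      refine Finset.sum_eq_zero fun k _ => ?_
      split_ifs with h1
      · refine Finset.sum_eq_zero fun l _ => if_neg fun h2 => h ⟨by omega, by omega⟩
      · rfl
  have h2 : (corner N A * ι.transpose) * ι = corner N A := by
    have : ι.transpose * ι = 1 := by
      ext i j
      simp only [hι, Matrix.mul_apply, Matrix.of_apply, Matrix.transpose_apply, Matrix.one_apply]
      rw [Finset.sum_eq_single (Fin.castLE hNM i)]
      · simp [Fin.ext_iff]
      · intro k _ hk
        rw [if_neg (c := (k : ℕ) = i) fun h' => hk (Fin.ext h'), zero_mul]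
      · simp
    rw [Matrix.mul_assoc, this, Matrix.mul_one]
  rw [matDetTwo, matDetTwo, h1, Matrix.det_one_add_mul_comm, Matrix.trace_mul_comm, h2]

open scoped Matrix.Norms.Frobenius in
theorem HSBound.norm_matDetTwo_corner_sub_le {A B : EllTwo →L[ℂ] EllTwo} {c ε : ℝ}
    (hA : HSBound A c) (hB : HSBound B c) (hAB : HSBound (A - B) ε) (N : ℕ) :
    ‖matDetTwo (corner N A) - matDetTwo (corner N B)‖ ≤ ε * Real.exp ((c + 1) ^ 2 / 2) :=
  norm_matDetTwo_sub_le (hA.norm_corner_le N) (hB.norm_corner_le N)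
    (by rw [← map_sub]; exact hAB.norm_corner_le N)

theorem HSBound.exists_tendsto_matDetTwo {A : EllTwo →L[ℂ] EllTwo} {c : ℝ} (h : HSBound A c) :
    ∃ d, Tendsto (fun N => matDetTwo (corner N A)) atTop (𝓝 d) := by
  refine cauchySeq_tendsto_of_complete (Metric.cauchySeq_iff'.2 fun ε hε => ?_)
  set E := Real.exp ((c + 1) ^ 2 / 2) with hE
  have hE0 : 0 < E := Real.exp_pos _
  obtain ⟨N, hN⟩ := (h.eventually_sub_trunc (ε := ε / (2 * E)) (by positivity)).exists
  refine ⟨N, fun M hM => ?_⟩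
  -- Rewriting the value at `N` as one of size `M` puts both matrices in the same space, where the
  -- Lipschitz bound applies.
  rw [dist_eq_norm, ← matDetTwo_corner_trunc hM]
  refine (h.norm_matDetTwo_corner_sub_le (h.trunc N) hN M).trans_lt ?_
  rw [← hE, div_mul_eq_mul_div, div_lt_iff₀ (by positivity)]
  nlinarith

/-! ### The regularized determinant -/

section ExpRemainder

open Nat

/-- The entire function `∑ X ^ k / (k + 2)! = (e ^ X - 1 - X) / X²`. -/
noncomputable def expRem (X : EllTwo →L[ℂ] EllTwo) : EllTwo →L[ℂ] EllTwo :=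
  ∑' k : ℕ, ((k + 2)! : ℂ)⁻¹ • X ^ k

theorem norm_expRem_term_le {X : EllTwo →L[ℂ] EllTwo} {R : ℝ} (hX : ‖X‖ ≤ R) (k : ℕ) :
    ‖((k + 2)! : ℂ)⁻¹ • X ^ k‖ ≤ R ^ k / k ! := by
  have hR : 0 ≤ R := (norm_nonneg _).trans hX
  rw [norm_smul, norm_inv, Complex.norm_natCast, inv_mul_eq_div]
  have h1 : ‖X ^ k‖ ≤ R ^ k := by
    rcases Nat.eq_zero_or_pos k with rfl | hk
    · rw [pow_zero, pow_zero]; exact ContinuousLinearMap.norm_id_le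
    · exact (norm_pow_le' X hk).trans (pow_le_pow_left₀ (norm_nonneg _) hX _)
  gcongr
  omega

theorem summable_expRem (X : EllTwo →L[ℂ] EllTwo) :
    Summable fun k : ℕ => ((k + 2)! : ℂ)⁻¹ • X ^ k :=
  Summable.of_norm_bounded (Real.summable_pow_div_factorial ‖X‖) (norm_expRem_term_le le_rfl)

theorem continuous_expRem : Continuous expRem := by
  refine continuous_iff_continuousAt.2 fun X => ?_
  have h : ContinuousOn expRem (Metric.ball 0 (‖X‖ + 1)) :=
    continuousOn_tsum (fun k => (by fun_prop : Continuous fun Y : EllTwo →L[ℂ] EllTwo => ((k + 2)! : ℂ)⁻¹ • Y ^ k).continuousOn)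
      (Real.summable_pow_div_factorial (‖X‖ + 1))
      (fun k Y hY => norm_expRem_term_le (by rw [mem_ball_zero_iff] at hY; exact hY.le) k)
  exact h.continuousAt (Metric.isOpen_ball.mem_nhds (by simp))

theorem exp_eq_add_expRem (X : EllTwo →L[ℂ] EllTwo) :
    NormedSpace.exp X = 1 + X + X * expRem X * X := by
  have h1 := NormedSpace.exp_series_hasSum_exp' (𝕂 := ℂ) X
  rw [← hasSum_nat_add_iff' 2] at h1
  have h2 : HasSum (fun k : ℕ => ((k + 2)! : ℂ)⁻¹ • X ^ (k + 2)) (X * expRem X * X) := by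
    have := ((summable_expRem X).hasSum.mul_left X).mul_right X
    refine this.congr_fun fun k => ?_
    rw [mul_smul_comm, smul_mul_assoc, pow_succ X (k + 1), pow_succ' X k]
  rw [h2.unique h1]
  simp [Finset.sum_range_succ]

/-- The bounded factor `G` in `(1 + A) e^{-A} - 1 = A G A`. -/
noncomputable def regFactor (A : EllTwo →L[ℂ] EllTwo) : EllTwo →L[ℂ] EllTwo :=
  -1 + (1 + A) * expRem (-A)

theorem continuous_regFactor : Continuous regFactor := by
  unfold regFactor
  have := continuous_expRem
  fun_prop

/-- The terms of first order cancel in `(1 + A) e^{-A}`, which leaves a Hilbert–Schmidt factor on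
each side of a bounded operator. -/
theorem regPart_eq (A : EllTwo →L[ℂ] EllTwo) : regPart A = A * (regFactor A * A) := by
  rw [regPart, exp_eq_add_expRem, regFactor]
  noncomm_ring

end ExpRemainder

theorem HSBound.isTraceClass_regPart {A : EllTwo →L[ℂ] EllTwo} {c : ℝ} (h : HSBound A c) :
    IsTraceClass (regPart A) :=
  ⟨A, regFactor A * A, h.isHilbertSchmidt, (h.mul_left _).isHilbertSchmidt, regPart_eq A⟩

theorem sectionDet_regPart_trunc (N : ℕ) (A : EllTwo →L[ℂ] EllTwo) :
    sectionDet (regPart (trunc N A)) N = matDetTwo (corner N A) := by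
  have h := trunc_mul_truncProj N A
  have h' : -trunc N A * truncProj N = -trunc N A := by rw [neg_mul, h]
  have h1 : (1 : Matrix (Fin N) (Fin N) ℂ) + corner N (regPart (trunc N A))
      = (1 + corner N A) * NormedSpace.exp (-corner N A) := by
    rw [← corner_one, ← map_add, regPart, add_sub_cancel, add_mul, one_mul, map_add, corner_one,
      add_mul, one_mul]
    -- The inserted projection allows the corner of the product to be split into a product of
    -- corners.
    nth_rewrite 2 [← h]
    rw [corner_mul_truncProj_mul, corner_exp_of_mul_truncProj h', map_neg, corner_trunc]
  rw [sectionDet_eq, h1, Matrix.det_mul, det_exp_eq, Matrix.trace_neg, matDetTwo]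

/-! ### Stability of section determinants under trace-class approximation. -/

theorem one_add_det_eq {n : Type*} [Fintype n] [DecidableEq n] (M : Matrix n n ℂ) :
    (1 + M).det = matDetTwo M * Complex.exp M.trace := by
  rw [matDetTwo, mul_assoc, ← Complex.exp_add, neg_add_cancel, Complex.exp_zero, mul_one]

/-- A common bound for the Hilbert–Schmidt norm of `B` and the sum of the absolute values of its
diagonal entries. -/
def TraceBound (B : EllTwo →L[ℂ] EllTwo) (c : ℝ) : Prop :=
  HSBound B c ∧ ∀ s : Finset ℕ, ∑ i ∈ s, ‖⟪deltaVec i, B (deltaVec i)⟫_ℂ‖ ≤ c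

theorem HSBound.traceBound_mul {A B : EllTwo →L[ℂ] EllTwo} {c d : ℝ} (hA : HSBound A c)
    (hB : HSBound B d) : TraceBound (A * B) (c * d) :=
  ⟨hA.mul hB, hA.sum_diag_mul_le hB⟩

theorem TraceBound.add {A B : EllTwo →L[ℂ] EllTwo} {c d : ℝ} (hA : TraceBound A c)
    (hB : TraceBound B d) : TraceBound (A + B) (c + d) := by
  refine ⟨hA.1.add hB.1, fun s => le_trans ?_ (add_le_add (hA.2 s) (hB.2 s))⟩
  rw [← Finset.sum_add_distrib]
  refine Finset.sum_le_sum fun i _ => ?_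
  rw [add_apply, inner_add_right]
  exact norm_add_le _ _

theorem TraceBound.mono {A : EllTwo →L[ℂ] EllTwo} {c d : ℝ} (hA : TraceBound A c)
    (h : c ≤ d) : TraceBound A d :=
  ⟨hA.1.mono h, fun s => (hA.2 s).trans h⟩

theorem TraceBound.norm_trace_corner_le {A : EllTwo →L[ℂ] EllTwo} {c : ℝ} (h : TraceBound A c)
    (N : ℕ) : ‖(corner N A).trace‖ ≤ c := by
  refine le_trans ?_ (h.2 (Finset.range N))
  rw [← Fin.sum_univ_eq_sum_range (fun i => ‖⟪deltaVec i, A (deltaVec i)⟫_ℂ‖) N]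
  exact norm_sum_le _ _

open scoped Matrix.Norms.Frobenius in
/-- Along a sequence converging in trace norm, the section determinants approach each other. -/
theorem tendsto_sectionDet_sub {B : EllTwo →L[ℂ] EllTwo} {C : ℕ → EllTwo →L[ℂ] EllTwo} {c : ℝ}
    (hB : TraceBound B c) (hC : ∀ N, TraceBound (C N) c)
    (hBC : ∀ ε > 0, ∀ᶠ N in atTop, TraceBound (B - C N) ε) :
    Tendsto (fun N => sectionDet B N - sectionDet (C N) N) atTop (𝓝 0) := by
  have hD : Tendsto (fun N => matDetTwo (corner N B) - matDetTwo (corner N (C N))) atTop (𝓝 0) := by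
    rw [tendsto_zero_iff_norm_tendsto_zero, Metric.tendsto_nhds]
    intro ε hε
    set E := Real.exp ((c + 1) ^ 2 / 2) with hE
    have hE0 : 0 < E := Real.exp_pos _
    filter_upwards [hBC (ε / (2 * E)) (by positivity)] with N hN
    simp only [dist_zero_right, norm_norm]
    refine (hB.1.norm_matDetTwo_corner_sub_le (hC N).1 hN.1 N).trans_lt ?_
    rw [← hE, div_mul_eq_mul_div, div_lt_iff₀ (by positivity)]
    nlinarith
  have hT : Tendsto (fun N => (corner N B).trace - (corner N (C N)).trace) atTop (𝓝 0) := by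
    rw [tendsto_zero_iff_norm_tendsto_zero, Metric.tendsto_nhds]
    intro ε hε
    filter_upwards [hBC (ε / 2) (by positivity)] with N hN
    simp only [dist_zero_right, norm_norm, ← Matrix.trace_sub, ← map_sub]
    exact (hN.norm_trace_corner_le N).trans_lt (half_lt_self hε)
  have hexp : Tendsto (fun N => Complex.exp ((corner N B).trace - (corner N (C N)).trace) - 1)
      atTop (𝓝 0) := by
    have := (Complex.continuous_exp.tendsto 0).comp hT
    rw [Complex.exp_zero] at this
    simpa using this.sub_const 1
  have hb1 : ∀ (A : EllTwo →L[ℂ] EllTwo), TraceBound A c → ∀ N,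
      ‖Complex.exp (corner N A).trace‖ ≤ Real.exp c := fun A hA N => by
    rw [Complex.norm_exp]
    exact Real.exp_le_exp.2 ((Complex.re_le_norm _).trans (hA.norm_trace_corner_le N))
  have hb2 : ∀ N, ‖sectionDet (C N) N‖ ≤ Real.exp (c ^ 2 / 2) * Real.exp c := fun N => by
    rw [sectionDet_eq, one_add_det_eq, norm_mul]
    refine mul_le_mul ((norm_matDetTwo_le _).trans ?_) (hb1 _ (hC N) N) (norm_nonneg _)
      (Real.exp_pos _).le
    refine Real.exp_le_exp.2 ?_
    have := (hC N).1.norm_corner_le N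
    linarith [pow_le_pow_left₀ (norm_nonneg _) this 2]
  -- With `d` for `matDetTwo` and `t` for the trace of the corner, the difference is `(d_B - d_C)
  -- e^{t_B} + d_C e^{t_C} (e^{t_B - t_C} - 1)`.
  have h1 := hD.zero_mul_isBoundedUnder_le
    (g := fun N => Complex.exp (corner N B).trace) (isBoundedUnder_of ⟨_, hb1 B hB⟩)
  have h2 := hexp.zero_mul_isBoundedUnder_le
    (g := fun N => sectionDet (C N) N) (isBoundedUnder_of ⟨_, hb2⟩)
  have h3 := h1.add h2
  rw [add_zero] at h3
  refine h3.congr fun N => ?_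
  simp only [sectionDet_eq, one_add_det_eq]
  rw [Complex.exp_sub]
  field_simp
  ring

/-- This identifies the Fredholm determinant defining `detTwo` with the limit of `matDetTwo`. The
two agree exactly for `trunc N A` at size `N`, and replacing `A` by its truncation changes `regPart`
little in the sense of `TraceBound`. -/
theorem HSBound.tendsto_sectionDet_regPart {A : EllTwo →L[ℂ] EllTwo} {c : ℝ} (h : HSBound A c)
    {d : ℂ} (hd : Tendsto (fun N => matDetTwo (corner N A)) atTop (𝓝 d)) :
    Tendsto (sectionDet (regPart A)) atTop (𝓝 d) := by
  have hop : Tendsto (fun N => _root_.trunc N A) atTop (𝓝 A) := by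
    rw [tendsto_iff_norm_sub_tendsto_zero, Metric.tendsto_nhds]
    intro ε hε
    filter_upwards [h.eventually_sub_trunc (half_pos hε)] with N hN
    rw [dist_zero_right, norm_norm, norm_sub_rev]
    exact hN.norm_le.trans_lt (half_lt_self hε)
  have hG := (continuous_regFactor.tendsto A).comp hop
  obtain ⟨g, hg⟩ := (Metric.isBounded_range_of_tendsto _ hG).exists_norm_le
  have hgN : ∀ N, ‖regFactor (_root_.trunc N A)‖ ≤ g := fun N => hg _ ⟨N, rfl⟩
  have hgA : ‖regFactor A‖ ≤ g := le_of_tendsto hG.norm (Eventually.of_forall hgN)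
  have hg0 : 0 ≤ g := (norm_nonneg _).trans hgA
  have hbound : ∀ (B : EllTwo →L[ℂ] EllTwo), HSBound B c → ‖regFactor B‖ ≤ g →
      TraceBound (regPart B) (c * (g * c)) := fun B hB hgB => by
    rw [regPart_eq]
    exact (hB.traceBound_mul (hB.mul_left _)).mono
      (mul_le_mul_of_nonneg_left (mul_le_mul_of_nonneg_right hgB hB.1) hB.1)
  have hlim := tendsto_sectionDet_sub (C := fun N => regPart (_root_.trunc N A))
    (hbound A h hgA) (fun N => hbound _ (h.trunc N) (hgN N)) (fun ε hε => by
      -- The three-term telescoping of `A G A - A' G' A'` below costs `(2 * g + c) * c` times the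
      -- error; the added ones make `K` positive.
      set K := (2 * g + c + 1) * (c + 1) with hK
      have hc := h.1
      have hK0 : 0 < K := by positivity
      have hη : 0 < ε / K := by positivity
      have hG' : ∀ᶠ N in atTop, ‖regFactor A - regFactor (_root_.trunc N A)‖ < ε / K := by
        have := Metric.tendsto_nhds.1 hG _ hη
        filter_upwards [this] with N hN
        rwa [dist_comm, dist_eq_norm] at hN
      filter_upwards [h.eventually_sub_trunc hη, hG'] with N h1 h2
      have hA' := h.trunc N
      set A' := _root_.trunc N A
      have e : regPart A - regPart A' = (A - A') * (regFactor A * A)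
          + A' * ((regFactor A - regFactor A') * A) + A' * (regFactor A' * (A - A')) := by
        rw [regPart_eq, regPart_eq]; noncomm_ring
      rw [e]
      have t1 := (h1.traceBound_mul (h.mul_left (regFactor A)))
      have t2 := (hA'.traceBound_mul (h.mul_left (regFactor A - regFactor A')))
      have t3 := (hA'.traceBound_mul (h1.mul_left (regFactor A')))
      refine ((t1.add t2).add t3).mono ?_
      calc _ ≤ ε / K * (g * c) + c * (ε / K * c) + c * (g * (ε / K)) := by
            have := hgN N
            gcongr
        _ = ε / K * ((2 * g + c) * c) := by ring
        _ ≤ ε / K * K := by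
            refine mul_le_mul_of_nonneg_left ?_ hη.le
            rw [hK]
            refine mul_le_mul ?_ ?_ hc (by positivity) <;> linarith
        _ = ε := div_mul_cancel₀ _ hK0.ne')
  have := hlim.add hd
  rw [zero_add] at this
  refine this.congr fun N => ?_
  rw [sectionDet_regPart_trunc]
  ring

theorem HSBound.tendsto_matDetTwo_corner {A : EllTwo →L[ℂ] EllTwo} {c : ℝ} (h : HSBound A c) :
    Tendsto (fun N => matDetTwo (corner N A)) atTop (𝓝 (detTwo A)) := by
  obtain ⟨d, hd⟩ := h.exists_tendsto_matDetTwo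
  have : detTwo A = d := (h.tendsto_sectionDet_regPart hd).limUnder_eq
  rwa [this]

theorem HSBound.tendsto_sectionDet {A : EllTwo →L[ℂ] EllTwo} {c : ℝ} (h : HSBound A c) :
    Tendsto (sectionDet (regPart A)) atTop (𝓝 (detTwo A)) :=
  h.tendsto_sectionDet_regPart h.tendsto_matDetTwo_corner

theorem HSBound.norm_detTwo_sub_le {A B : EllTwo →L[ℂ] EllTwo} {c ε : ℝ}
    (hA : HSBound A c) (hB : HSBound B c) (hAB : HSBound (A - B) ε) :
    ‖detTwo A - detTwo B‖ ≤ ε * Real.exp ((c + 1) ^ 2 / 2) :=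
  le_of_tendsto (hA.tendsto_matDetTwo_corner.sub hB.tendsto_matDetTwo_corner).norm
    (Eventually.of_forall fun N => hA.norm_matDetTwo_corner_sub_le hB hAB N)

theorem detTwo_zero : detTwo 0 = 1 := by
  have h : HSBound 0 0 := ⟨le_rfl, fun s => by simp⟩
  refine tendsto_nhds_unique h.tendsto_matDetTwo_corner ?_
  simp [matDetTwo_zero]

/-! ### The free resolvent -/

local notation "S" => shiftOp
local notation "S†" => ContinuousLinearMap.adjoint shiftOp

theorem norm_shiftOp_le : ‖S‖ ≤ 1 := LinearMap.mkContinuous_norm_le _ zero_le_one _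

theorem norm_adjoint_shiftOp_le : ‖S†‖ ≤ 1 := by
  rw [LinearIsometryEquiv.norm_map]; exact norm_shiftOp_le

theorem shiftOp_mul_adjoint : S * S† = 1 := by
  ext x n
  rw [mul_apply_eq_comp, shiftOp_apply, shiftOp_adjoint_apply]
  simp

theorem shiftOp_deltaVec_zero : S (deltaVec 0) = 0 := by
  ext n
  rw [shiftOp_apply, deltaVec_apply]
  simp

theorem shiftOp_deltaVec_succ (k : ℕ) : S (deltaVec (k + 1)) = deltaVec k := by
  ext n
  rw [shiftOp_apply, deltaVec_apply, deltaVec_apply]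
  simp

theorem freeJacobi_eq : freeJacobi = S + S† := by
  have h1 : diagOp (fun _ => 1) = 1 := by
    ext x n
    rw [diagOp_apply ⟨1, by simp⟩]
    simp
  have h0 : diagOp (fun _ => 0) = 0 := by
    ext x n
    rw [diagOp_apply ⟨0, by simp⟩]
    simp
  rw [freeJacobi, jacobiOp, h1, h0, one_mul, mul_one, add_zero]

theorem isUnit_one_sub_smul {z : ℂ} (hz : ‖z‖ < 1) {X : EllTwo →L[ℂ] EllTwo} (hX : ‖X‖ ≤ 1) :
    IsUnit (1 - z • X) := by
  refine isUnit_one_sub_of_norm_lt_one ?_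
  rw [norm_smul]
  exact (mul_le_of_le_one_right (norm_nonneg _) hX).trans_lt hz

/-- The operator `(1 + z² - z J₀)⁻¹`, a multiple of the free resolvent. -/
noncomputable def freeGreen (z : ℂ) : EllTwo →L[ℂ] EllTwo :=
  Ring.inverse (1 - z • S†) * Ring.inverse (1 - z • S)

/-- The order of the factors matters: `S S† = 1`, whereas `S† S` misses `δ_0`. -/
theorem one_add_sq_sub_freeJacobi (z : ℂ) :
    (1 + z ^ 2) • (1 : EllTwo →L[ℂ] EllTwo) - z • freeJacobi = (1 - z • S) * (1 - z • S†) := by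
  have h : (z • S) * (z • S†) = z ^ 2 • (1 : EllTwo →L[ℂ] EllTwo) := by
    rw [smul_mul_smul_comm, shiftOp_mul_adjoint, sq]
  rw [sub_mul, mul_sub, mul_sub, h, freeJacobi_eq, one_mul, mul_one, one_mul, smul_add, add_smul,
    one_smul]
  abel

theorem one_sub_mul_freeGreen {z : ℂ} (hz : ‖z‖ < 1) :
    (1 - z • S†) * freeGreen z = Ring.inverse (1 - z • S) := by
  rw [freeGreen, ← mul_assoc, Ring.mul_inverse_cancel _
    (isUnit_one_sub_smul hz norm_adjoint_shiftOp_le), one_mul]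

theorem mul_freeGreen {z : ℂ} (hz : ‖z‖ < 1) :
    ((1 + z ^ 2) • (1 : EllTwo →L[ℂ] EllTwo) - z • freeJacobi) * freeGreen z = 1 := by
  rw [one_add_sq_sub_freeJacobi, mul_assoc, one_sub_mul_freeGreen hz,
    Ring.mul_inverse_cancel _ (isUnit_one_sub_smul hz norm_shiftOp_le)]

theorem freeGreen_mul {z : ℂ} (hz : ‖z‖ < 1) :
    freeGreen z * ((1 + z ^ 2) • (1 : EllTwo →L[ℂ] EllTwo) - z • freeJacobi) = 1 := by
  rw [one_add_sq_sub_freeJacobi, freeGreen, mul_assoc, ← mul_assoc _ (1 - z • S),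
    Ring.inverse_mul_cancel _ (isUnit_one_sub_smul hz norm_shiftOp_le), one_mul,
    Ring.inverse_mul_cancel _ (isUnit_one_sub_smul hz norm_adjoint_shiftOp_le)]

theorem freeResolvent_eq {z : ℂ} (hz : ‖z‖ < 1) : freeResolvent z = -z • freeGreen z := by
  rcases eq_or_ne z 0 with rfl | h0
  · simp [freeResolvent]
  have e : freeJacobi - (z + z⁻¹) • (1 : EllTwo →L[ℂ] EllTwo)
      = -z⁻¹ • ((1 + z ^ 2) • (1 : EllTwo →L[ℂ] EllTwo) - z • freeJacobi) := by
    have e1 : -z⁻¹ * (1 + z ^ 2) = -(z + z⁻¹) := by field_simp; ring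
    rw [smul_sub, smul_smul, smul_smul, e1, neg_mul, inv_mul_cancel₀ h0, neg_smul, neg_smul,
      one_smul]
    abel
  rw [freeResolvent, if_neg h0, e]
  refine Ring.inverse_unit ⟨_, -z • freeGreen z, ?_, ?_⟩
  · rw [smul_mul_smul_comm, mul_freeGreen hz, neg_mul_neg, inv_mul_cancel₀ h0, one_smul]
  · rw [smul_mul_smul_comm, freeGreen_mul hz, neg_mul_neg, mul_inv_cancel₀ h0, one_smul]

theorem perturbOp_eq (a b : ℕ → ℝ) {z : ℂ} (hz : ‖z‖ < 1) :
    perturbOp a b z = -z • ((jacobiOp a b - freeJacobi) * freeGreen z) := by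
  rw [perturbOp, freeResolvent_eq hz, mul_smul_comm]

theorem continuousOn_freeGreen : ContinuousOn freeGreen (Metric.ball 0 1) := by
  intro z hz
  rw [mem_ball_zero_iff] at hz
  have key : ∀ X : EllTwo →L[ℂ] EllTwo, ‖X‖ ≤ 1 →
      ContinuousAt (fun w : ℂ => Ring.inverse (1 - w • X)) z := fun X hX => by
    obtain ⟨u, hu⟩ := isUnit_one_sub_smul hz hX
    have h1 := NormedRing.inverse_continuousAt u
    rw [hu] at h1
    exact ContinuousAt.comp (f := fun w : ℂ => 1 - w • X) h1 (by fun_prop)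
  exact ((key _ norm_adjoint_shiftOp_le).mul (key _ norm_shiftOp_le)).continuousWithinAt

theorem continuousOn_freeResolvent : ContinuousOn freeResolvent (Metric.ball 0 1) := by
  refine (continuousOn_id.neg.smul continuousOn_freeGreen).congr fun z hz => ?_
  exact freeResolvent_eq (mem_ball_zero_iff.1 hz)

theorem inverse_one_sub_shiftOp_apply {z : ℂ} (hz : ‖z‖ < 1) (j n : ℕ) :
    Ring.inverse (1 - z • S) (deltaVec j) n = if n ≤ j then z ^ (j - n) else 0 := by
  have hinv := Ring.inverse_mul_cancel _ (isUnit_one_sub_smul hz norm_shiftOp_le)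
  induction j with
  | zero =>
    have h := congrArg (fun X : EllTwo →L[ℂ] EllTwo => X (deltaVec 0)) hinv
    simp only [mul_apply_eq_comp, sub_apply, one_apply_eq_self, smul_apply, shiftOp_deltaVec_zero,
      smul_zero, sub_zero] at h
    rw [h, deltaVec_apply]
    split_ifs <;> simp_all
  | succ j ih =>
    have h := congrArg (fun X : EllTwo →L[ℂ] EllTwo => X (deltaVec (j + 1)) n) hinv
    simp only [mul_apply_eq_comp, sub_apply, one_apply_eq_self, smul_apply, shiftOp_deltaVec_succ,
      map_sub, map_smul, lp.coeFn_sub, lp.coeFn_smul, Pi.sub_apply, Pi.smul_apply, smul_eq_mul,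
      ih, deltaVec_apply] at h
    rw [sub_eq_iff_eq_add] at h
    rw [h]
    rcases lt_trichotomy n (j + 1) with hn | hn | hn
    · rw [if_neg hn.ne, if_pos (by omega), if_pos (by omega), zero_add, ← pow_succ']
      congr 1; omega
    · simp [hn]
    · rw [if_neg hn.ne', if_neg (by omega), if_neg (by omega)]; simp

theorem freeGreen_apply_rec {z : ℂ} (hz : ‖z‖ < 1) (j n : ℕ) :
    freeGreen z (deltaVec j) n = (if n ≤ j then z ^ (j - n) else 0)
      + z * (if n = 0 then 0 else freeGreen z (deltaVec j) (n - 1)) := by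
  have h := congrArg (fun X : EllTwo →L[ℂ] EllTwo => X (deltaVec j) n) (one_sub_mul_freeGreen hz)
  simp only [mul_apply_eq_comp, sub_apply, one_apply_eq_self, smul_apply, lp.coeFn_sub,
    lp.coeFn_smul, Pi.sub_apply, Pi.smul_apply, smul_eq_mul, inverse_one_sub_shiftOp_apply hz,
    shiftOp_adjoint_apply] at h
  rw [← h]
  ring

/-- Below the diagonal each column is geometric. The row just outside a corner is therefore `z`
times the last row inside it, so cutting off a section costs only a correction of one diagonal
entry. -/
theorem freeGreen_apply_succ {z : ℂ} (hz : ‖z‖ < 1) {j n : ℕ} (h : j ≤ n) :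
    freeGreen z (deltaVec j) (n + 1) = z * freeGreen z (deltaVec j) n := by
  rw [freeGreen_apply_rec hz, if_neg (by omega), if_neg (by omega), zero_add, Nat.add_sub_cancel]

theorem one_sub_sq_ne_zero {z : ℂ} (hz : ‖z‖ < 1) : 1 - z ^ 2 ≠ 0 := by
  intro h
  have h1 : ‖z‖ ^ 2 = 1 := by rw [← norm_pow, ← sub_eq_zero.1 h, norm_one]
  nlinarith [norm_nonneg z]

theorem freeGreen_apply_of_le {z : ℂ} (hz : ‖z‖ < 1) {i j : ℕ} (h : i ≤ j) :
    freeGreen z (deltaVec j) i = z ^ (j - i) * ((1 - z ^ (2 * (i + 1))) / (1 - z ^ 2)) := by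
  have h0 := one_sub_sq_ne_zero hz
  induction i with
  | zero =>
    rw [freeGreen_apply_rec hz, if_pos h]
    simp [h0]
  | succ i ih =>
    rw [freeGreen_apply_rec hz, if_pos h, if_neg (by omega), Nat.add_sub_cancel, ih (by omega)]
    obtain ⟨k, rfl⟩ := Nat.exists_eq_add_of_le h
    have e1 : i + 1 + k - (i + 1) = k := by omega
    have e2 : i + 1 + k - i = k + 1 := by omega
    rw [e1, e2]
    field_simp
    ring

/-! ### Admissible Jacobi parameters -/

/-- Jacobi parameters that are square summable and conditionally summable perturbations of the free
ones. -/
structure Admissible (a b : ℕ → ℝ) : Prop where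
  summable_sq : Summable fun n => |a n - 1| ^ 2 + |b n| ^ 2
  exists_sum_a : ∃ s : ℝ, Tendsto (fun N => ∑ n ∈ Finset.range N, (a n - 1)) atTop (𝓝 s)
  exists_sum_b : ∃ s : ℝ, Tendsto (fun N => ∑ n ∈ Finset.range N, b n) atTop (𝓝 s)

theorem tendsto_sum_strip {f : ℕ → ℝ} {s : ℝ}
    (h : Tendsto (fun N => ∑ n ∈ Finset.range N, f n) atTop (𝓝 s)) (n : ℕ) :
    Tendsto (fun N => ∑ k ∈ Finset.range N, f (k + n)) atTop
      (𝓝 (s - ∑ k ∈ Finset.range n, f k)) := by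
  refine (((tendsto_add_atTop_iff_nat n).2 h).sub_const (∑ k ∈ Finset.range n, f k)).congr
    fun N => ?_
  rw [add_comm N n, Finset.sum_range_add]
  simp [add_comm]

theorem strip_strip (m n : ℕ) (c : ℕ → ℝ) : strip m (strip n c) = strip (m + n) c := by
  ext k; simp [strip, add_assoc]

theorem strip_zero (c : ℕ → ℝ) : strip 0 c = c := rfl

theorem exists_bound_of_summable_sq {f : ℕ → ℝ} (h : Summable fun n => f n ^ 2) :
    ∃ C, ∀ n, |f n| ≤ C := by
  refine ⟨√(∑' n, f n ^ 2), fun n => Real.abs_le_sqrt ?_⟩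
  exact h.le_tsum n fun _ _ => by positivity

namespace Admissible

variable {a b : ℕ → ℝ}

theorem strip (h : Admissible a b) (n : ℕ) : Admissible (strip n a) (strip n b) where
  summable_sq := (summable_nat_add_iff (f := fun n => |a n - 1| ^ 2 + |b n| ^ 2) n).2 h.summable_sq
  exists_sum_a := let ⟨_, hs⟩ := h.exists_sum_a
    ⟨_, tendsto_sum_strip (f := fun n => a n - 1) hs n⟩
  exists_sum_b := let ⟨_, hs⟩ := h.exists_sum_b
    ⟨_, tendsto_sum_strip hs n⟩

theorem summable_a (h : Admissible a b) : Summable fun n => (a n - 1) ^ 2 :=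
  Summable.of_nonneg_of_le (fun _ => by positivity)
    (fun n => by rw [sq_abs, sq_abs]; nlinarith [sq_nonneg (b n)]) h.summable_sq

theorem summable_b (h : Admissible a b) : Summable fun n => b n ^ 2 :=
  Summable.of_nonneg_of_le (fun _ => by positivity)
    (fun n => by rw [sq_abs, sq_abs]; nlinarith [sq_nonneg (a n - 1)]) h.summable_sq

theorem bound_sub (h : Admissible a b) : ∃ C, ∀ n, |a n - 1| ≤ C :=
  exists_bound_of_summable_sq h.summable_a

theorem bound_b (h : Admissible a b) : ∃ C, ∀ n, |b n| ≤ C :=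
  exists_bound_of_summable_sq h.summable_b

theorem bound_a (h : Admissible a b) : ∃ C, ∀ n, |a n| ≤ C := by
  obtain ⟨C, hC⟩ := h.bound_sub
  refine ⟨C + 1, fun n => ?_⟩
  have := abs_add_le (a n - 1) 1
  rw [sub_add_cancel, abs_one] at this
  linarith [hC n]

theorem jacobiOp_sub (h : Admissible a b) :
    jacobiOp a b - freeJacobi = jacobiOp (fun n => a n - 1) b := by
  ext x n
  rw [sub_apply, lp.coeFn_sub, Pi.sub_apply, jacobiOp_apply h.bound_a h.bound_b, freeJacobi,
    jacobiOp_apply ⟨1, by simp⟩ ⟨0, by simp⟩, jacobiOp_apply h.bound_sub h.bound_b]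
  split_ifs <;> push_cast <;> ring

end Admissible

theorem hsBound_diagOp {c : ℕ → ℝ} {d : ℝ} (hd : 0 ≤ d)
    (h : ∀ s : Finset ℕ, ∑ n ∈ s, c n ^ 2 ≤ d ^ 2) : HSBound (diagOp c) d := by
  have hb : ∃ C, ∀ n, |c n| ≤ C := ⟨d, fun n => abs_le_of_sq_le_sq (by simpa using h {n}) hd⟩
  refine ⟨hd, fun s => le_trans (le_of_eq (Finset.sum_congr rfl fun j _ => ?_)) (h s)⟩
  have : diagOp c (deltaVec j) = (c j : ℂ) • deltaVec j := by
    ext n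
    rw [diagOp_apply hb, lp.coeFn_smul, Pi.smul_apply, deltaVec_apply, smul_eq_mul]
    split_ifs with h
    · rw [h]
    · simp
  rw [this, norm_smul, norm_deltaVec, mul_one, Complex.norm_real, Real.norm_eq_abs, sq_abs]

/-- The `ℓ²` size of the perturbation of the free Jacobi parameters. -/
noncomputable def perturbSize (a b : ℕ → ℝ) : ℝ := √(∑' n, (|a n - 1| ^ 2 + |b n| ^ 2))

theorem tendsto_perturbSize (a b : ℕ → ℝ) :
    Tendsto (fun n => perturbSize (strip n a) (strip n b)) atTop (𝓝 0) := by
  have := (Real.continuous_sqrt.tendsto 0).comp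
    (tendsto_sum_nat_add fun n => |a n - 1| ^ 2 + |b n| ^ 2)
  rwa [Real.sqrt_zero] at this

namespace Admissible

variable {a b : ℕ → ℝ}

/-- One unit of `perturbSize` is spent on each of the upper, main and lower diagonals. -/
theorem hsBound_sub (h : Admissible a b) :
    HSBound (jacobiOp a b - freeJacobi) (3 * perturbSize a b) := by
  have h0 : 0 ≤ perturbSize a b := Real.sqrt_nonneg _
  have hsq : perturbSize a b ^ 2 = ∑' n, (|a n - 1| ^ 2 + |b n| ^ 2) :=
    Real.sq_sqrt (tsum_nonneg fun _ => by positivity)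
  have ha : HSBound (diagOp fun n => a n - 1) (perturbSize a b) := hsBound_diagOp h0 fun s => by
    rw [hsq]
    refine le_trans (Finset.sum_le_sum fun n _ => ?_)
      (h.summable_sq.sum_le_tsum s fun _ _ => by positivity)
    rw [sq_abs]; nlinarith [sq_nonneg |b n|]
  have hb : HSBound (diagOp b) (perturbSize a b) := hsBound_diagOp h0 fun s => by
    rw [hsq]
    refine le_trans (Finset.sum_le_sum fun n _ => ?_)
      (h.summable_sq.sum_le_tsum s fun _ _ => by positivity)
    rw [sq_abs (b n)]; nlinarith [sq_nonneg |a n - 1|]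
  rw [h.jacobiOp_sub, jacobiOp]
  refine (((ha.mul_right S).add hb).add (ha.mul_left S†)).mono ?_
  nlinarith [norm_shiftOp_le, norm_adjoint_shiftOp_le]

theorem hsBound_perturbOp (h : Admissible a b) (z : ℂ) :
    HSBound (perturbOp a b z) (3 * perturbSize a b * ‖freeResolvent z‖) :=
  h.hsBound_sub.mul_right _

theorem hsBound_perturbOp_sub (h : Admissible a b) (z w : ℂ) :
    HSBound (perturbOp a b z - perturbOp a b w)
      (3 * perturbSize a b * ‖freeResolvent z - freeResolvent w‖) := by
  rw [perturbOp, perturbOp, ← mul_sub]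
  exact h.hsBound_sub.mul_right _

/-! ### The trace -/

/-- Each `a n - 1` contributes equally to the diagonal entries `n` and `n + 1`, hence the factor `2`
in `traceSum`. For the last index the second contribution lies outside the corner, which gives the
extra term. -/
theorem trace_corner_perturbOp (h : Admissible a b) {z : ℂ} (hz : ‖z‖ < 1) (N : ℕ) :
    (corner (N + 1) (perturbOp a b z)).trace = traceSum a b z (N + 1)
      + z ^ 2 * ((a N - 1 : ℝ) : ℂ) * ((1 - z ^ (2 * (N + 1))) / (1 - z ^ 2)) := by
  have h0 := one_sub_sq_ne_zero hz
  have hentry : ∀ i, perturbOp a b z (deltaVec i) i =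
      -z * (((a i - 1 : ℝ) : ℂ) * (z * ((1 - z ^ (2 * (i + 1))) / (1 - z ^ 2)))
        + (b i : ℂ) * ((1 - z ^ (2 * (i + 1))) / (1 - z ^ 2))
        + if i = 0 then 0 else ((a (i - 1) - 1 : ℝ) : ℂ)
            * (z * ((1 - z ^ (2 * i)) / (1 - z ^ 2)))) := fun i => by
    rw [perturbOp_eq a b hz, smul_apply, lp.coeFn_smul, Pi.smul_apply, mul_apply_eq_comp,
      h.jacobiOp_sub, jacobiOp_apply h.bound_sub h.bound_b, freeGreen_apply_succ hz le_rfl,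
      freeGreen_apply_of_le hz le_rfl, Nat.sub_self, pow_zero, one_mul, smul_eq_mul]
    rcases Nat.eq_zero_or_pos i with rfl | hi
    · simp
    · rw [if_neg hi.ne', if_neg hi.ne', freeGreen_apply_of_le hz (Nat.sub_le i 1),
        Nat.sub_sub_self hi, Nat.sub_add_cancel hi, pow_one]
  have htr : ∀ M, (corner M (perturbOp a b z)).trace
      = ∑ i ∈ Finset.range M, perturbOp a b z (deltaVec i) i := fun M => by
    simp only [Matrix.trace, Matrix.diag, corner_apply]
    exact Fin.sum_univ_eq_sum_range (fun i => perturbOp a b z (deltaVec i) i) M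
  rw [htr]
  induction N with
  | zero =>
    rw [Finset.sum_range_one, hentry, traceSum]
    push_cast
    field_simp
    simp
    ring
  | succ N ih =>
    rw [Finset.sum_range_succ, ih, hentry, traceSum, traceSum,
      Finset.sum_range_succ _ (N + 1), Finset.sum_range_succ _ (N + 1)]
    rw [if_neg (by omega), Nat.add_sub_cancel]
    push_cast
    field_simp
    ring

theorem tendsto_trace_sub (h : Admissible a b) {z : ℂ} (hz : ‖z‖ < 1) :
    Tendsto (fun N => (corner N (perturbOp a b z)).trace - traceSum a b z N) atTop (𝓝 0) := by
  rw [← tendsto_add_atTop_iff_nat 1]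
  simp only [h.trace_corner_perturbOp hz, add_sub_cancel_left]
  have h1 : Tendsto (fun N => ((a N - 1 : ℝ) : ℂ)) atTop (𝓝 ((0 : ℝ) : ℂ)) := by
    refine (Complex.continuous_ofReal.tendsto 0).comp ?_
    have := (Real.continuous_sqrt.tendsto 0).comp h.summable_a.tendsto_atTop_zero
    simp only [Function.comp_def, Real.sqrt_sq_eq_abs, Real.sqrt_zero] at this
    exact (tendsto_zero_iff_abs_tendsto_zero _).2 this
  have h2 : Tendsto (fun N : ℕ => z ^ (2 * (N + 1))) atTop (𝓝 0) :=
    (tendsto_pow_atTop_nhds_zero_of_norm_lt_one hz).comp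
      (tendsto_atTop_mono (fun N => by simp only [id]; omega) tendsto_id)
  simpa using (h1.const_mul (z ^ 2)).mul ((h2.const_sub 1).div_const (1 - z ^ 2))

end Admissible

/-! ### The renormalized trace -/

/-- The sum of the conditionally convergent series `∑ f n (1 - z ^ (2 (n + 1)))`, where `s` is the
sum of `∑ f n`. -/
noncomputable def condSeries (f : ℕ → ℝ) (s : ℝ) (z : ℂ) : ℂ :=
  (s : ℂ) - ∑' n, (f n : ℂ) * z ^ (2 * (n + 1))

section CondSeries

variable {f : ℕ → ℝ} {s C r : ℝ} {z : ℂ}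

theorem norm_condSeries_term_le (hf : ∀ n, |f n| ≤ C) (hz : ‖z‖ ≤ r) (n : ℕ) :
    ‖(f n : ℂ) * z ^ (2 * (n + 1))‖ ≤ C * (r ^ 2) ^ (n + 1) := by
  rw [norm_mul, Complex.norm_real, norm_pow, pow_mul]
  exact mul_le_mul (hf n) (by gcongr) (by positivity) ((abs_nonneg _).trans (hf 0))

theorem summable_condSeries_bound (C : ℝ) (h0 : 0 ≤ r) (hr : r < 1) :
    Summable fun n : ℕ => C * (r ^ 2) ^ (n + 1) :=
  ((summable_nat_add_iff 1).2 (summable_geometric_of_lt_one (by positivity)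
    (by nlinarith))).mul_left C

theorem tendsto_condSeries (hf : ∀ n, |f n| ≤ C)
    (hs : Tendsto (fun N => ∑ n ∈ Finset.range N, f n) atTop (𝓝 s)) (hz : ‖z‖ < 1) :
    Tendsto (fun N => ∑ n ∈ Finset.range N, (f n : ℂ) * (1 - z ^ (2 * (n + 1)))) atTop
      (𝓝 (condSeries f s z)) := by
  have h1 : Summable fun n => (f n : ℂ) * z ^ (2 * (n + 1)) :=
    Summable.of_norm_bounded (summable_condSeries_bound C (norm_nonneg z) hz)
      (norm_condSeries_term_le hf le_rfl)
  refine (((Complex.continuous_ofReal.tendsto s).comp hs).sub h1.hasSum.tendsto_sum_nat).congr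
    fun N => ?_
  simp [mul_sub, Finset.sum_sub_distrib]

theorem continuousOn_condSeries (hf : ∀ n, |f n| ≤ C) :
    ContinuousOn (condSeries f s) (Metric.ball 0 1) := by
  intro z hz
  obtain ⟨r, hr, hr1⟩ := exists_between (mem_ball_zero_iff.1 hz)
  have h : ContinuousOn (condSeries f s) (Metric.ball 0 r) :=
    continuousOn_const.sub (continuousOn_tsum (fun n => by fun_prop)
      (summable_condSeries_bound C ((norm_nonneg z).trans hr.le) hr1)
      fun n w hw => norm_condSeries_term_le hf (mem_ball_zero_iff.1 hw).le n)
  exact (h.continuousAt (Metric.isOpen_ball.mem_nhds (mem_ball_zero_iff.2 hr))).continuousWithinAt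

theorem norm_condSeries_le (hf : ∀ n, |f n| ≤ C) (hs : |s| ≤ C) (hz : ‖z‖ ≤ r) (hr : r < 1) :
    ‖condSeries f s z‖ ≤ C * (1 + r ^ 2 / (1 - r ^ 2)) := by
  have h0 : 0 ≤ r := (norm_nonneg z).trans hz
  have h1 : ‖∑' n, (f n : ℂ) * z ^ (2 * (n + 1))‖ ≤ ∑' n : ℕ, C * (r ^ 2) ^ (n + 1) :=
    tsum_of_norm_bounded (summable_condSeries_bound C h0 hr).hasSum (norm_condSeries_term_le hf hz)
  have h2 : ∑' n : ℕ, C * (r ^ 2) ^ (n + 1) = C * (r ^ 2 / (1 - r ^ 2)) := by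
    have h3 : ∀ n : ℕ, C * (r ^ 2) ^ (n + 1) = C * r ^ 2 * (r ^ 2) ^ n := fun n => by ring
    simp only [h3, tsum_mul_left]
    rw [tsum_geometric_of_lt_one (by positivity) (by nlinarith)]
    ring
  rw [mul_add, mul_one, ← h2]
  refine (norm_sub_le _ _).trans (add_le_add ?_ h1)
  rwa [Complex.norm_real]

theorem tendsto_zero_of_tendsto_sum
    (hs : Tendsto (fun N => ∑ n ∈ Finset.range N, f n) atTop (𝓝 s)) : Tendsto f atTop (𝓝 0) := by
  have := ((tendsto_add_atTop_iff_nat 1).2 hs).sub hs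
  simpa [Finset.sum_range_succ] using this

theorem exists_bound_of_tendsto_sum
    (hs : Tendsto (fun N => ∑ n ∈ Finset.range N, f n) atTop (𝓝 s)) : ∃ C, ∀ n, |f n| ≤ C := by
  obtain ⟨C, hC⟩ := (Metric.isBounded_range_of_tendsto _
    (tendsto_zero_of_tendsto_sum hs)).exists_norm_le
  exact ⟨C, fun n => hC _ ⟨n, rfl⟩⟩

/-- Convergence along `atTop ×ˢ 𝓟 K` is uniform convergence on `K`. The tail of the conditionally
convergent sum and the supremum of the remaining terms are both small, and the powers of `z` are
summable uniformly on the smaller disk. -/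
theorem tendsto_condSeries_strip
    (hs : Tendsto (fun N => ∑ n ∈ Finset.range N, f n) atTop (𝓝 s)) (hr : r < 1) :
    Tendsto (fun p : ℕ × ℂ =>
        condSeries (strip p.1 f) (s - ∑ k ∈ Finset.range p.1, f k) p.2)
      (atTop ×ˢ 𝓟 (Metric.closedBall 0 r)) (𝓝 0) := by
  rcases lt_or_ge r 0 with h0 | h0
  · rw [Metric.closedBall_eq_empty.2 h0]; simp
  rw [Metric.tendsto_nhds]
  intro ε hε
  have hK : 0 < 1 + r ^ 2 / (1 - r ^ 2) := by
    have : 0 < 1 - r ^ 2 := by nlinarith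
    positivity
  have hη : 0 < ε / (2 * (1 + r ^ 2 / (1 - r ^ 2))) := by positivity
  have h1 : ∀ᶠ n in atTop, |s - ∑ k ∈ Finset.range n, f k| ≤ ε / (2 * (1 + r ^ 2 / (1 - r ^ 2))) := by
    filter_upwards [Metric.tendsto_nhds.1 hs _ hη] with n hn
    rw [dist_comm, Real.dist_eq] at hn
    exact hn.le
  have h2 : ∀ᶠ n in atTop, ∀ k, |strip n f k| ≤ ε / (2 * (1 + r ^ 2 / (1 - r ^ 2))) := by
    obtain ⟨n₀, hn₀⟩ := eventually_atTop.1
      (Metric.tendsto_nhds.1 (tendsto_zero_of_tendsto_sum hs) _ hη)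
    filter_upwards [eventually_ge_atTop n₀] with n hn k
    have := hn₀ (k + n) (by omega)
    rw [Real.dist_eq, sub_zero] at this
    exact this.le
  rw [eventually_prod_principal_iff]
  filter_upwards [h1, h2] with n h1 h2 z hz
  rw [dist_zero_right]
  refine (norm_condSeries_le h2 h1 (mem_closedBall_zero_iff.1 hz) hr).trans_lt ?_
  rw [div_mul_eq_mul_div, div_lt_iff₀ (by positivity)]
  nlinarith

end CondSeries

theorem tendsto_traceSum {a b : ℕ → ℝ} {s t : ℝ}
    (ha : Tendsto (fun N => ∑ n ∈ Finset.range N, (a n - 1)) atTop (𝓝 s))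
    (hb : Tendsto (fun N => ∑ n ∈ Finset.range N, b n) atTop (𝓝 t)) {z : ℂ} (hz : ‖z‖ < 1) :
    Tendsto (traceSum a b z) atTop (𝓝 (-(z / (1 - z ^ 2)) *
      (condSeries b t z + 2 * (z * condSeries (fun n => a n - 1) s z)))) := by
  obtain ⟨C, hC⟩ := exists_bound_of_tendsto_sum ha
  obtain ⟨D, hD⟩ := exists_bound_of_tendsto_sum hb
  refine (((tendsto_condSeries hD hb hz).add
    (((tendsto_condSeries hC ha hz).const_mul z).const_mul 2)).const_mul _).congr fun N => ?_
  rw [traceSum, Finset.mul_sum]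
  congr 3
  refine Finset.sum_congr rfl fun n _ => ?_
  push_cast
  ring

theorem renTrace_eq {a b : ℕ → ℝ} {s t : ℝ}
    (ha : Tendsto (fun N => ∑ n ∈ Finset.range N, (a n - 1)) atTop (𝓝 s))
    (hb : Tendsto (fun N => ∑ n ∈ Finset.range N, b n) atTop (𝓝 t)) {z : ℂ} (hz : ‖z‖ < 1) :
    renTrace a b z = -(z / (1 - z ^ 2)) *
      (condSeries b t z + 2 * (z * condSeries (fun n => a n - 1) s z)) :=
  (tendsto_traceSum ha hb hz).limUnder_eq

namespace Admissible

variable {a b : ℕ → ℝ}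

theorem tendsto_traceSum (h : Admissible a b) {z : ℂ} (hz : ‖z‖ < 1) :
    Tendsto (traceSum a b z) atTop (𝓝 (renTrace a b z)) := by
  obtain ⟨s, ha⟩ := h.exists_sum_a
  obtain ⟨t, hb⟩ := h.exists_sum_b
  rw [renTrace_eq ha hb hz]
  exact _root_.tendsto_traceSum ha hb hz

theorem continuousOn_renTrace (h : Admissible a b) :
    ContinuousOn (renTrace a b) (Metric.ball 0 1) := by
  obtain ⟨s, ha⟩ := h.exists_sum_a
  obtain ⟨t, hb⟩ := h.exists_sum_b
  obtain ⟨C, hC⟩ := exists_bound_of_tendsto_sum ha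
  obtain ⟨D, hD⟩ := exists_bound_of_tendsto_sum hb
  have h1 := continuousOn_condSeries (s := s) hC
  have h2 := continuousOn_condSeries (s := t) hD
  refine ContinuousOn.congr (f := fun z => -(z / (1 - z ^ 2)) *
    (condSeries b t z + 2 * (z * condSeries (fun n => a n - 1) s z))) ?_
    fun z hz => renTrace_eq ha hb (mem_ball_zero_iff.1 hz)
  have h3 : ContinuousOn (fun z : ℂ => z / (1 - z ^ 2)) (Metric.ball 0 1) :=
    ContinuousOn.div (by fun_prop) (by fun_prop)
      fun z hz => one_sub_sq_ne_zero (mem_ball_zero_iff.1 hz)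
  fun_prop

/-! ### Continuity of the renormalized determinant and its limit under stripping. -/

theorem continuousOn_renDet (h : Admissible a b) :
    ContinuousOn (renDet a b) (Metric.ball 0 1) := by
  refine ContinuousOn.mul (fun z hz => ?_) h.continuousOn_renTrace.cexp
  have hR := (continuousOn_freeResolvent.continuousAt (Metric.isOpen_ball.mem_nhds hz))
  refine ContinuousAt.continuousWithinAt ?_
  have h0 : 0 ≤ perturbSize a b := Real.sqrt_nonneg _
  set c := 3 * perturbSize a b * (‖freeResolvent z‖ + 1) with hc
  have hev : ∀ᶠ w in 𝓝 z, ‖freeResolvent w‖ ≤ ‖freeResolvent z‖ + 1 :=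
    (hR.norm.eventually_lt continuousAt_const (lt_add_one _)).mono fun _ h => h.le
  rw [ContinuousAt, tendsto_iff_norm_sub_tendsto_zero]
  refine squeeze_zero' (g := fun w => 3 * perturbSize a b * ‖freeResolvent w - freeResolvent z‖
    * Real.exp ((c + 1) ^ 2 / 2)) (Eventually.of_forall fun _ => norm_nonneg _) ?_ ?_
  · filter_upwards [hev] with w hw
    refine HSBound.norm_detTwo_sub_le ((h.hsBound_perturbOp w).mono ?_)
      ((h.hsBound_perturbOp z).mono ?_) (h.hsBound_perturbOp_sub w z)
    · exact mul_le_mul_of_nonneg_left hw (by positivity)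
    · exact mul_le_mul_of_nonneg_left (by linarith) (by positivity)
  · have := ((tendsto_iff_norm_sub_tendsto_zero.1 hR).const_mul (3 * perturbSize a b)).mul_const
      (Real.exp ((c + 1) ^ 2 / 2))
    simpa using this

theorem tendsto_detTwo_strip (h : Admissible a b) {r : ℝ} (hr : r < 1) :
    Tendsto (fun p : ℕ × ℂ => detTwo (perturbOp (_root_.strip p.1 a) (_root_.strip p.1 b) p.2))
      (atTop ×ˢ 𝓟 (Metric.closedBall 0 r)) (𝓝 1) := by
  obtain ⟨M, hM⟩ := (isCompact_closedBall (0 : ℂ) r).exists_bound_of_continuousOn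
    (continuousOn_freeResolvent.mono (Metric.closedBall_subset_ball hr))
  have hlim : Tendsto (fun p : ℕ × ℂ =>
      3 * perturbSize (_root_.strip p.1 a) (_root_.strip p.1 b) * M)
      (atTop ×ˢ 𝓟 (Metric.closedBall 0 r)) (𝓝 0) := by
    have := ((tendsto_perturbSize a b).const_mul 3).mul_const M
    rw [mul_zero, zero_mul] at this
    exact this.comp tendsto_fst
  rw [tendsto_iff_norm_sub_tendsto_zero]
  have hg : Tendsto (fun x : ℝ => x * Real.exp ((x + 1) ^ 2 / 2)) (𝓝 0) (𝓝 0) := by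
    have : Continuous fun x : ℝ => x * Real.exp ((x + 1) ^ 2 / 2) := by fun_prop
    simpa using this.tendsto 0
  refine squeeze_zero' (Eventually.of_forall fun _ => norm_nonneg _) ?_ (hg.comp hlim)
  rw [eventually_prod_principal_iff]
  refine Eventually.of_forall fun n z hz => ?_
  have hA := ((h.strip n).hsBound_perturbOp z).mono
    (mul_le_mul_of_nonneg_left (hM z hz) (mul_nonneg (by norm_num) (Real.sqrt_nonneg _)))
  -- The comparison operator is `0`, with determinant `1`; the Hilbert–Schmidt bound serves both as
  -- radius and as distance.
  have h0 : HSBound (0 : EllTwo →L[ℂ] EllTwo)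
      (3 * perturbSize (_root_.strip n a) (_root_.strip n b) * M) := 
    ⟨hA.1, fun s => by simpa using sq_nonneg _⟩
  have := hA.norm_detTwo_sub_le h0 (by rwa [sub_zero])
  rwa [detTwo_zero] at this

theorem tendsto_renTrace_strip (h : Admissible a b) {r : ℝ} (hr : r < 1) :
    Tendsto (fun p : ℕ × ℂ => renTrace (_root_.strip p.1 a) (_root_.strip p.1 b) p.2)
      (atTop ×ˢ 𝓟 (Metric.closedBall 0 r)) (𝓝 0) := by
  obtain ⟨s, ha⟩ := h.exists_sum_a
  obtain ⟨t, hb⟩ := h.exists_sum_b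
  have h3 : ContinuousOn (fun z : ℂ => z / (1 - z ^ 2)) (Metric.closedBall 0 r) :=
    ContinuousOn.div (by fun_prop) (by fun_prop)
      fun z hz => one_sub_sq_ne_zero ((mem_closedBall_zero_iff.1 hz).trans_lt hr)
  obtain ⟨M, hM⟩ := (isCompact_closedBall (0 : ℂ) r).exists_bound_of_continuousOn h3
  have hmem : ∀ᶠ p : ℕ × ℂ in atTop ×ˢ 𝓟 (Metric.closedBall 0 r), p.2 ∈ Metric.closedBall 0 r :=
    (eventually_principal.2 fun _ h => h).prod_inr _
  have hz : IsBoundedUnder (· ≤ ·) (atTop ×ˢ 𝓟 (Metric.closedBall 0 r))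
      (norm ∘ fun p : ℕ × ℂ => p.2) :=
    isBoundedUnder_of_eventually_le (a := r) (hmem.mono fun p hp => mem_closedBall_zero_iff.1 hp)
  have hq : IsBoundedUnder (· ≤ ·) (atTop ×ˢ 𝓟 (Metric.closedBall 0 r))
      (norm ∘ fun p : ℕ × ℂ => -(p.2 / (1 - p.2 ^ 2))) :=
    isBoundedUnder_of_eventually_le (a := M) (hmem.mono fun p hp => by simpa using hM _ hp)
  have h1 := tendsto_condSeries_strip hb hr
  have h2 := isBoundedUnder_le_mul_tendsto_zero hz (tendsto_condSeries_strip ha hr)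
  have h5 := h1.add (h2.const_mul 2)
  rw [mul_zero, add_zero] at h5
  have h4 := isBoundedUnder_le_mul_tendsto_zero hq h5
  refine h4.congr' (hmem.mono fun p hp => ?_)
  exact (renTrace_eq (tendsto_sum_strip ha p.1) (tendsto_sum_strip hb p.1)
    ((mem_closedBall_zero_iff.1 hp).trans_lt hr)).symm

/-- The renormalized determinants of the stripped matrices tend to `1` locally uniformly. -/
theorem tendsto_renDet_strip (h : Admissible a b) {r : ℝ} (hr : r < 1) :
    Tendsto (fun p : ℕ × ℂ => renDet (_root_.strip p.1 a) (_root_.strip p.1 b) p.2)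
      (atTop ×ˢ 𝓟 (Metric.closedBall 0 r)) (𝓝 1) := by
  simpa [renDet] using (h.tendsto_detTwo_strip hr).mul (h.tendsto_renTrace_strip hr).cexp

theorem renDet_zero (a b : ℕ → ℝ) : renDet a b 0 = 1 := by
  have h1 : perturbOp a b 0 = 0 := by simp [perturbOp, freeResolvent]
  have h2 : renTrace a b 0 = 0 := by
    refine Tendsto.limUnder_eq ?_
    have : traceSum a b 0 = fun _ => 0 := by ext N; simp [traceSum]
    rw [this]
    exact tendsto_const_nhds
  rw [renDet, h1, h2, detTwo_zero, Complex.exp_zero, one_mul]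

end Admissible

/-! ### Tridiagonal determinants -/

/-- The symmetric tridiagonal matrix with diagonal `D` and off-diagonal `e`. -/
def triMatrix (D e : ℕ → ℂ) (N : ℕ) : Matrix (Fin N) (Fin N) ℂ :=
  Matrix.of fun i j =>
    (if (j : ℕ) = i then D i else 0) + (if (j : ℕ) = i + 1 then e i else 0)
      + (if (i : ℕ) = j + 1 then e j else 0)

/-- Laplace expansion along the first row; the second minor is then expanded along its first column.
-/
theorem det_triMatrix_succ_succ (D e : ℕ → ℂ) (N : ℕ) :
    (triMatrix D e (N + 2)).det
      = D 0 * (triMatrix (fun n => D (n + 1)) (fun n => e (n + 1)) (N + 1)).det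
        - e 0 ^ 2 * (triMatrix (fun n => D (n + 2)) (fun n => e (n + 2)) N).det := by
  have h1 : (triMatrix D e (N + 2)).submatrix Fin.succ (Fin.succAbove 0)
      = triMatrix (fun n => D (n + 1)) (fun n => e (n + 1)) (N + 1) := by
    ext i j
    simp [triMatrix]
  have h2 : ((triMatrix D e (N + 2)).submatrix Fin.succ (Fin.succAbove 1)).det
      = e 0 * (triMatrix (fun n => D (n + 2)) (fun n => e (n + 2)) N).det := by
    rw [Matrix.det_succ_column_zero, Fin.sum_univ_succ, Finset.sum_eq_zero]
    · have h3 : ((triMatrix D e (N + 2)).submatrix Fin.succ (Fin.succAbove 1)).submatrix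
          (Fin.succAbove 0) Fin.succ
          = triMatrix (fun n => D (n + 2)) (fun n => e (n + 2)) N := by
        ext i j
        have : (Fin.succAbove (1 : Fin (N + 2)) j.succ) = j.succ.succ := by
          rw [← Fin.succ_zero_eq_one, Fin.succ_succAbove_succ, Fin.zero_succAbove]
        simp [triMatrix, this]
      rw [h3]
      simp [triMatrix]
    · intro i _
      simp [triMatrix]
  rw [Matrix.det_succ_row_zero, Fin.sum_univ_succ, Fin.sum_univ_succ, Finset.sum_eq_zero]
  · rw [h1, Fin.succ_zero_eq_one, h2]
    simp [triMatrix]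
    ring
  · intro i _
    simp [triMatrix]

theorem triMatrix_sum (D e : ℕ → ℂ) {N i : ℕ} (hi : i < N) (y : ℕ → ℂ) :
    ∑ k : Fin N, triMatrix D e N ⟨i, hi⟩ k * y k
      = D i * y i + (if i + 1 < N then e i * y (i + 1) else 0)
        + (if i = 0 then 0 else e (i - 1) * y (i - 1)) := by
  simp only [triMatrix, Matrix.of_apply, add_mul, ite_mul, zero_mul, Finset.sum_add_distrib]
  rw [Fin.sum_univ_eq_sum_range (fun k => if k = i then D i * y k else 0),
    Fin.sum_univ_eq_sum_range (fun k => if k = i + 1 then e i * y k else 0),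
    Fin.sum_univ_eq_sum_range (fun k => if i = k + 1 then e k * y k else 0)]
  congr 1
  · rw [Finset.sum_ite_eq', Finset.sum_ite_eq']
    simp [hi]
  · rcases Nat.eq_zero_or_pos i with rfl | h0
    · simp
    · rw [if_neg h0.ne']
      have : ∀ k, (i = k + 1) = (k = i - 1) := fun k => propext (by omega)
      simp only [this]
      rw [Finset.sum_ite_eq', if_pos (Finset.mem_range.2 (by omega))]

/-! ### Finite approximations of the renormalized determinant -/

/-- The diagonal of the `N × N` matrix whose determinant approximates the renormalized
determinant: that of `1 + z² - z J`, with a boundary correction in the last entry. -/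
noncomputable def jostDiag (a b : ℕ → ℝ) (z : ℂ) (N i : ℕ) : ℂ :=
  1 + z ^ 2 - z * b i - if i + 1 = N then a i * z ^ 2 else 0

/-- The determinant of the `N × N` corner of `1 + δJ (J₀ - (z + z⁻¹))⁻¹`. -/
noncomputable def jostDet (a b : ℕ → ℝ) (z : ℂ) (N : ℕ) : ℂ :=
  (triMatrix (jostDiag a b z N) (fun i => -z * a i) N).det

theorem jostDet_succ_succ (a b : ℕ → ℝ) (z : ℂ) (N : ℕ) :
    jostDet a b z (N + 2) = (1 + z ^ 2 - z * b 0) * jostDet (strip 1 a) (strip 1 b) z (N + 1)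
      - z ^ 2 * a 0 ^ 2 * jostDet (strip 2 a) (strip 2 b) z N := by
  rw [jostDet, det_triMatrix_succ_succ, jostDet, jostDet]
  have h1 : (fun n => jostDiag a b z (N + 2) (n + 1))
      = jostDiag (strip 1 a) (strip 1 b) z (N + 1) := by
    ext n; simp [jostDiag, strip]
  have h2 : (fun n => jostDiag a b z (N + 2) (n + 2)) = jostDiag (strip 2 a) (strip 2 b) z N := by
    ext n; simp [jostDiag, strip, add_right_comm n 2 1]
  have h0 : jostDiag a b z (N + 2) 0 = 1 + z ^ 2 - z * b 0 := by simp [jostDiag]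
  rw [h0, h1, h2, neg_mul, neg_sq, mul_pow]
  rfl

theorem jostDet_free (z : ℂ) (N : ℕ) : jostDet (fun _ => 1) (fun _ => 0) z N = 1 := by
  induction N using Nat.twoStepInduction with
  | zero => simp [jostDet]
  | one => simp [jostDet, triMatrix, jostDiag]
  | more N h1 h2 =>
    have e : ∀ m (c : ℝ), strip m (fun _ => c) = fun _ => c := fun m c => rfl
    rw [jostDet_succ_succ, e, e, e, e, h1, h2]
    push_cast
    ring

namespace Admissible

variable {a b : ℕ → ℝ}

/-- In infinite dimension `1 + A(z) = (1 + z² - z J) G` with `G = freeGreen z`. In the corner only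
the last row reaches outside; `freeGreen_apply_succ` absorbs its term `-z a G` into the diagonal as
`-z² a`, the correction in `jostDiag`. -/
theorem one_add_corner_perturbOp (h : Admissible a b) {z : ℂ} (hz : ‖z‖ < 1) (N : ℕ) :
    1 + corner N (perturbOp a b z)
      = triMatrix (jostDiag a b z N) (fun i => -z * a i) N * corner N (freeGreen z) := by
  have e : 1 + perturbOp a b z
      = ((1 + z ^ 2) • (1 : EllTwo →L[ℂ] EllTwo) - z • jacobiOp a b) * freeGreen z := by
    rw [perturbOp_eq a b hz]
    nth_rewrite 1 [← mul_freeGreen hz]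
    rw [← smul_mul_assoc, ← add_mul, smul_sub, neg_smul, neg_smul]
    congr 1
    abel
  rw [← corner_one, ← map_add, e]
  ext i j
  rw [corner_apply, mul_apply_eq_comp, Matrix.mul_apply]
  have h1 : ∀ k : Fin N, corner N (freeGreen z) k j = freeGreen z (deltaVec j) k := fun k => corner_apply _ _ _ _
  simp only [h1]
  have h2 := triMatrix_sum (jostDiag a b z N) (fun i => -z * a i) i.2 (freeGreen z (deltaVec j))
  simp only [Fin.eta] at h2
  rw [h2, sub_apply, smul_apply, smul_apply, one_apply_eq_self, lp.coeFn_sub, Pi.sub_apply,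
    lp.coeFn_smul, lp.coeFn_smul, Pi.smul_apply, Pi.smul_apply, smul_eq_mul, smul_eq_mul,
    jacobiOp_apply h.bound_a h.bound_b, jostDiag]
  by_cases hi : (i : ℕ) + 1 = N
  · have hlt : ¬ (i : ℕ) + 1 < N := by omega
    rw [if_pos hi, if_neg hlt, freeGreen_apply_succ hz (n := i) (by omega)]
    split_ifs <;> ring
  · have hlt : (i : ℕ) + 1 < N := by omega
    rw [if_neg hi, if_pos hlt]
    split_ifs <;> ring

end Admissible

theorem admissible_free : Admissible (fun _ => 1) (fun _ => 0) where
  summable_sq := by simp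
  exists_sum_a := ⟨0, by simp⟩
  exists_sum_b := ⟨0, by simp⟩

/-- The factorization is applied to the zero perturbation, where the left side is `1` and the
tridiagonal determinant is `1` by `jostDet_free`. -/
theorem det_corner_freeGreen {z : ℂ} (hz : ‖z‖ < 1) (N : ℕ) :
    (corner N (freeGreen z)).det = 1 := by
  have h := congrArg Matrix.det (admissible_free.one_add_corner_perturbOp hz N)
  have h0 : perturbOp (fun _ => 1) (fun _ => 0) z = 0 := by
    rw [perturbOp, ← freeJacobi, sub_self, zero_mul]
  have h1 := jostDet_free z N
  rw [jostDet] at h1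
  rw [Matrix.det_mul, h1, h0, map_zero, add_zero, Matrix.det_one, one_mul] at h
  exact h.symm

namespace Admissible

variable {a b : ℕ → ℝ}

theorem det_one_add_corner_perturbOp (h : Admissible a b) {z : ℂ} (hz : ‖z‖ < 1) (N : ℕ) :
    (1 + corner N (perturbOp a b z)).det = jostDet a b z N := by
  rw [h.one_add_corner_perturbOp hz, Matrix.det_mul, det_corner_freeGreen hz, mul_one, jostDet]

/-- A section determinant is the regularized one times the exponential of the trace of the corner,
and that trace has the same limit as `traceSum`. -/
theorem tendsto_jostDet (h : Admissible a b) {z : ℂ} (hz : ‖z‖ < 1) :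
    Tendsto (jostDet a b z) atTop (𝓝 (renDet a b z)) := by
  have h1 := (h.hsBound_perturbOp z).tendsto_matDetTwo_corner
  have h2 := (h.tendsto_trace_sub hz).add (h.tendsto_traceSum hz)
  rw [zero_add] at h2
  refine (h1.mul h2.cexp).congr fun N => ?_
  rw [← h.det_one_add_corner_perturbOp hz, one_add_det_eq, sub_add_cancel]

/-- The three-term recurrence for the renormalized determinants of the stripped matrices. -/
theorem renDet_rec (h : Admissible a b) {z : ℂ} (hz : ‖z‖ < 1) (n : ℕ) :
    renDet (_root_.strip n a) (_root_.strip n b) z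
      = (1 + z ^ 2 - z * b n) * renDet (_root_.strip (n + 1) a) (_root_.strip (n + 1) b) z
        - z ^ 2 * a n ^ 2 * renDet (_root_.strip (n + 2) a) (_root_.strip (n + 2) b) z := by
  -- Sections of sizes `N + 2`, `N + 1` and `N` end at the same row of `J`, so their boundary
  -- corrections match.
  refine tendsto_nhds_unique ((tendsto_add_atTop_iff_nat 2).2 ((h.strip n).tendsto_jostDet hz)) ?_
  refine (((((tendsto_add_atTop_iff_nat 1).2 ((h.strip (n + 1)).tendsto_jostDet hz))).const_mul
    (1 + z ^ 2 - z * b n)).sub (((h.strip (n + 2)).tendsto_jostDet hz).const_mul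
    (z ^ 2 * a n ^ 2))).congr fun N => ?_
  rw [jostDet_succ_succ, strip_strip, strip_strip, strip_strip, strip_strip, add_comm 1 n,
    add_comm 2 n]
  simp [_root_.strip]

end Admissible

/-! ### Convergence of `∑ (a n - 1)` -/

/-- Taking logarithms of the product gives convergence of `∑ log a_n`, and `a_n - 1 - log a_n` is
summable, being at most `2 (a_n - 1)²` once `a_n ≥ 1 / 2`. -/
theorem exists_tendsto_sum_sub_one {a : ℕ → ℝ} (ha : ∀ n, 0 < a n)
    (hsq : Summable fun n => (a n - 1) ^ 2) {P : ℝ} (hP : P ≠ 0)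
    (hprod : Tendsto (fun n => ∏ j ∈ Finset.range n, a j) atTop (𝓝 P)) :
    ∃ s : ℝ, Tendsto (fun N => ∑ n ∈ Finset.range N, (a n - 1)) atTop (𝓝 s) := by
  have hlog : Tendsto (fun N => ∑ n ∈ Finset.range N, Real.log (a n)) atTop (𝓝 (Real.log P)) := by
    refine (((Real.continuousAt_log hP).tendsto).comp hprod).congr fun N => ?_
    exact Real.log_prod fun n _ => (ha n).ne'
  have hev : ∀ᶠ n in atTop, 1 / 2 ≤ a n := by
    have h2 := hsq.tendsto_atTop_zero
    filter_upwards [h2.eventually_lt_const (show (0 : ℝ) < 1 / 4 by norm_num)] with n hn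
    nlinarith
  have hdiff : Summable fun n => a n - 1 - Real.log (a n) := by
    refine Summable.of_norm_bounded_eventually_nat (hsq.mul_left 2) ?_
    filter_upwards [hev] with n hn
    have h1 := Real.log_le_sub_one_of_pos (ha n)
    have h2 := Real.one_sub_inv_le_log_of_pos (ha n)
    rw [Real.norm_of_nonneg (by linarith)]
    have h3 : a n - 1 - (1 - (a n)⁻¹) = (a n - 1) ^ 2 * (a n)⁻¹ := by
      have := (ha n).ne'
      field_simp
    have h4 : (a n)⁻¹ ≤ 2 := by
      rw [inv_le_comm₀ (ha n) two_pos]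
      linarith
    nlinarith [mul_le_mul_of_nonneg_left h4 (sq_nonneg (a n - 1))]
  refine ⟨_, (hdiff.hasSum.tendsto_sum_nat.add hlog).congr fun N => ?_⟩
  rw [← Finset.sum_add_distrib]
  exact Finset.sum_congr rfl fun n _ => by ring

/-! ### The Weyl solution -/

namespace Admissible

variable {a b : ℕ → ℝ}

theorem tendsto_renDet_strip_apply (h : Admissible a b) {z : ℂ} (hz : ‖z‖ < 1) :
    Tendsto (fun n => renDet (_root_.strip n a) (_root_.strip n b) z) atTop (𝓝 1) := by
  have h1 : Tendsto (fun n : ℕ => (n, z)) atTop (atTop ×ˢ 𝓟 (Metric.closedBall (0 : ℂ) ‖z‖)) :=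
    tendsto_id.prodMk (tendsto_principal.2 (Eventually.of_forall fun _ => by simp))
  have h2 := (h.tendsto_renDet_strip hz).comp h1
  simpa only [Function.comp_def] using h2

/-- The Jost solution. -/
theorem exists_jostSolution (h : Admissible a b) {C : ℝ}
    (hC : ∀ n, |∏ j ∈ Finset.range n, a j| ≤ C) {z : ℂ} (hz : ‖z‖ < 1) (h0 : z ≠ 0) :
    ∃ x : EllTwo, (∀ k, x k = z ^ (k + 1) * ((∏ j ∈ Finset.range k, a j : ℝ) : ℂ)
        * renDet (_root_.strip (k + 1) a) (_root_.strip (k + 1) b) z) ∧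
      ((z + z⁻¹) • (1 : EllTwo →L[ℂ] EllTwo) - jacobiOp a b) x = renDet a b z • deltaVec 0 := by
  obtain ⟨D, hD⟩ := (Metric.isBounded_range_of_tendsto _
    (h.tendsto_renDet_strip_apply hz)).exists_norm_le
  have hmem : Memℓp (fun k : ℕ => z ^ (k + 1) * ((∏ j ∈ Finset.range k, a j : ℝ) : ℂ)
        * renDet (_root_.strip (k + 1) a) (_root_.strip (k + 1) b) z) 2 := by
    rw [memℓp_gen_iff (by norm_num)]
    have hg : Summable fun k : ℕ => (‖z‖ ^ 2) ^ k * (‖z‖ * C * D) ^ 2 :=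
      (summable_geometric_of_lt_one (by positivity) (by nlinarith [norm_nonneg z])).mul_right _
    refine Summable.of_nonneg_of_le (fun k => by positivity) (fun k => ?_) hg
    have h1 : ‖z ^ (k + 1) * ((∏ j ∈ Finset.range k, a j : ℝ) : ℂ)
        * renDet (_root_.strip (k + 1) a) (_root_.strip (k + 1) b) z‖ ≤ ‖z‖ ^ k * (‖z‖ * C * D) := by
      rw [norm_mul, norm_mul, norm_pow, Complex.norm_real, Real.norm_eq_abs, pow_succ]
      have h2 := hC k
      have h3 := hD _ ⟨k + 1, rfl⟩
      have h4 : 0 ≤ C := (abs_nonneg _).trans h2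
      calc _ ≤ ‖z‖ ^ k * ‖z‖ * C * D := by gcongr
        _ = _ := by ring
    have h2 := pow_le_pow_left₀ (norm_nonneg _) h1 2
    rw [mul_pow, ← pow_mul, mul_comm k 2, pow_mul] at h2
    simpa only [ENNReal.toReal_ofNat, Real.rpow_ofNat] using h2
  refine ⟨⟨_, hmem⟩, fun k => rfl, ?_⟩
  ext n
  rw [sub_apply, smul_apply, one_apply_eq_self, lp.coeFn_sub, Pi.sub_apply,
    lp.coeFn_smul, lp.coeFn_smul, Pi.smul_apply, Pi.smul_apply, smul_eq_mul, smul_eq_mul,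
    jacobiOp_apply h.bound_a h.bound_b, deltaVec_apply]
  change (z + z⁻¹) * (z ^ (n + 1) * ((∏ j ∈ Finset.range n, a j : ℝ) : ℂ)
        * renDet (_root_.strip (n + 1) a) (_root_.strip (n + 1) b) z)
      - ((a n : ℂ) * (z ^ (n + 1 + 1) * ((∏ j ∈ Finset.range (n + 1), a j : ℝ) : ℂ)
        * renDet (_root_.strip (n + 1 + 1) a) (_root_.strip (n + 1 + 1) b) z)
      + (b n : ℂ) * (z ^ (n + 1) * ((∏ j ∈ Finset.range n, a j : ℝ) : ℂ)
        * renDet (_root_.strip (n + 1) a) (_root_.strip (n + 1) b) z)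
      + if n = 0 then 0 else (a (n - 1) : ℂ) * (z ^ (n - 1 + 1)
        * ((∏ j ∈ Finset.range (n - 1), a j : ℝ) : ℂ)
        * renDet (_root_.strip (n - 1 + 1) a) (_root_.strip (n - 1 + 1) b) z))
      = renDet a b z * if n = 0 then 1 else 0
  have hrec := h.renDet_rec hz n
  have hE : (z + z⁻¹) * z ^ (n + 1) = (1 + z ^ 2) * z ^ n := by
    rw [pow_succ]; field_simp; ring
  -- At `n = 0` the source `L_0 δ_0` takes the place of the missing term `a_{n-1} x_{n-1}`, so one
  -- formula covers all rows.
  have key : (if n = 0 then (0 : ℂ) else (a (n - 1) : ℂ) * (z ^ (n - 1 + 1)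
        * ((∏ j ∈ Finset.range (n - 1), a j : ℝ) : ℂ)
        * renDet (_root_.strip (n - 1 + 1) a) (_root_.strip (n - 1 + 1) b) z))
      + renDet a b z * (if n = 0 then 1 else 0)
      = z ^ n * ((∏ j ∈ Finset.range n, a j : ℝ) : ℂ)
        * renDet (_root_.strip n a) (_root_.strip n b) z := by
    cases n with
    | zero => simp [strip_zero]
    | succ m =>
      rw [if_neg (Nat.succ_ne_zero m), if_neg (Nat.succ_ne_zero m), Nat.add_sub_cancel,
        Finset.prod_range_succ]
      push_cast
      ring
  rw [hrec] at key
  rw [Finset.prod_range_succ]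
  rw [← mul_assoc, ← mul_assoc, hE]
  push_cast at key ⊢
  linear_combination -key

theorem isUnit_of_mem_resolventDisk {z : ℂ} (hz : z ∈ resolventDisk a b) (h0 : z ≠ 0) :
    IsUnit ((z + z⁻¹) • (1 : EllTwo →L[ℂ] EllTwo) - jacobiOp a b) := by
  have := spectrum.notMem_iff.1 (hz.2.resolve_left h0)
  rwa [Algebra.algebraMap_eq_smul_one] at this

/-- At a zero, the Jost solution lies in the kernel of an invertible operator and vanishes; then all
later determinants vanish, although they tend to `1`. -/
theorem renDet_ne_zero (h : Admissible a b) (ha : ∀ n, a n ≠ 0) {C : ℝ}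
    (hC : ∀ n, |∏ j ∈ Finset.range n, a j| ≤ C) {z : ℂ} (hz : z ∈ resolventDisk a b) :
    renDet a b z ≠ 0 := by
  rcases eq_or_ne z 0 with rfl | h0
  · simp [renDet_zero]
  intro hL
  obtain ⟨x, hx, hJ⟩ := h.exists_jostSolution hC hz.1 h0
  rw [hL, zero_smul] at hJ
  have hinv := Ring.inverse_mul_cancel _ (isUnit_of_mem_resolventDisk hz h0)
  have hx0 : x = 0 := by
    have := congrArg (fun X : EllTwo →L[ℂ] EllTwo => X x) hinv
    simpa only [mul_apply_eq_comp, hJ, map_zero, one_apply_eq_self] using this.symm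
  have hzero : ∀ k, renDet (_root_.strip (k + 1) a) (_root_.strip (k + 1) b) z = 0 := fun k => by
    have := hx k
    rw [hx0, lp.coeFn_zero, Pi.zero_apply, eq_comm, mul_eq_zero, mul_eq_zero] at this
    refine this.resolve_left ?_
    rintro (h1 | h1)
    · exact h0 (by simpa using h1)
    · exact Finset.prod_ne_zero_iff.2 (fun j _ => ha j) (Complex.ofReal_eq_zero.1 h1)
  have hlim := (tendsto_add_atTop_iff_nat 1).2 (h.tendsto_renDet_strip_apply hz.1)
  simp only [hzero] at hlim
  exact zero_ne_one (tendsto_nhds_unique tendsto_const_nhds hlim)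

theorem weylRaw_eq (h : Admissible a b) (ha : ∀ n, a n ≠ 0) {C : ℝ}
    (hC : ∀ n, |∏ j ∈ Finset.range n, a j| ≤ C) {z : ℂ} (hz : z ∈ resolventDisk a b) (h0 : z ≠ 0)
    (k : ℕ) :
    weylRaw a b k z = z ^ (k + 1) * (((∏ j ∈ Finset.range k, a j : ℝ) : ℂ) *
      (renDet (_root_.strip (k + 1) a) (_root_.strip (k + 1) b) z / renDet a b z)) := by
  have hL := h.renDet_ne_zero ha hC hz
  obtain ⟨x, hx, hJ⟩ := h.exists_jostSolution hC hz.1 h0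
  have hinv := Ring.inverse_mul_cancel _ (isUnit_of_mem_resolventDisk hz h0)
  have h1 := congrArg (fun X : EllTwo →L[ℂ] EllTwo => X x k) hinv
  simp only [mul_apply_eq_comp, hJ, map_smul, one_apply_eq_self, lp.coeFn_smul, Pi.smul_apply,
    smul_eq_mul, hx] at h1
  rw [weylRaw, inner_deltaVec]
  rw [← mul_div_assoc, ← mul_div_assoc, eq_div_iff hL]
  linear_combination h1

/-! ### The removable singularities at zero. -/

theorem eventually_mem_resolventDisk (a b : ℕ → ℝ) :
    ∀ᶠ z in 𝓝[≠] (0 : ℂ), z ∈ resolventDisk a b := by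
  -- Multiplying `z + z⁻¹ - J` by `z` gives a family continuous at `0` with value `1` there, and the
  -- units form an open set.
  have h1 : ∀ᶠ z in 𝓝 (0 : ℂ),
      IsUnit ((1 + z ^ 2) • (1 : EllTwo →L[ℂ] EllTwo) - z • jacobiOp a b) := by
    have hc : Continuous fun z : ℂ =>
        (1 + z ^ 2) • (1 : EllTwo →L[ℂ] EllTwo) - z • jacobiOp a b := by fun_prop
    refine hc.continuousAt.eventually_mem (Units.isOpen.mem_nhds ?_)
    simp
  have h2 : ∀ᶠ z in 𝓝 (0 : ℂ), ‖z‖ < 1 := by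
    filter_upwards [Metric.ball_mem_nhds (0 : ℂ) one_pos] with z hz
    exact mem_ball_zero_iff.1 hz
  filter_upwards [h1.filter_mono nhdsWithin_le_nhds, h2.filter_mono nhdsWithin_le_nhds,
    self_mem_nhdsWithin] with z hu hz h0
  refine ⟨hz, Or.inr (spectrum.notMem_iff.2 ?_)⟩
  rw [Algebra.algebraMap_eq_smul_one]
  have h0' : z ≠ 0 := h0
  have e : (z + z⁻¹) • (1 : EllTwo →L[ℂ] EllTwo) - jacobiOp a b
      = (Units.mk0 z h0')⁻¹ • ((1 + z ^ 2) • (1 : EllTwo →L[ℂ] EllTwo) - z • jacobiOp a b) := by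
    rw [Units.smul_def, Units.val_inv_eq_inv_val, Units.val_mk0, smul_sub, smul_smul, smul_smul,
      inv_mul_cancel₀ h0', one_smul]
    congr 2
    field_simp
    ring
  rw [e]
  exact (isUnit_smul_iff _ _).2 hu

theorem tendsto_renDet_ratio (h : Admissible a b) (n : ℕ) :
    Tendsto (fun z => renDet (_root_.strip n a) (_root_.strip n b) z / renDet a b z)
      (𝓝[≠] 0) (𝓝 1) := by
  have hc : ∀ {a b : ℕ → ℝ}, Admissible a b → Tendsto (renDet a b) (𝓝[≠] 0) (𝓝 1) :=
    fun {a b} h => by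
      have := (h.continuousOn_renDet.continuousAt (Metric.ball_mem_nhds (0 : ℂ) one_pos)).tendsto
      rw [renDet_zero] at this
      exact this.mono_left nhdsWithin_le_nhds
  have h1 := (hc (h.strip n)).div (hc h) one_ne_zero
  rwa [div_one] at h1

theorem tendsto_weylRaw_normalized (h : Admissible a b) (ha : ∀ n, a n ≠ 0) {C : ℝ}
    (hC : ∀ n, |∏ j ∈ Finset.range n, a j| ≤ C) (k : ℕ) :
    Tendsto (fun z => (z ^ (k + 1))⁻¹ * weylRaw a b k z) (𝓝[≠] 0)
      (𝓝 ((∏ j ∈ Finset.range k, a j : ℝ) : ℂ)) := by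
  have h1 := (h.tendsto_renDet_ratio (k + 1)).const_mul ((∏ j ∈ Finset.range k, a j : ℝ) : ℂ)
  rw [mul_one] at h1
  refine h1.congr' ?_
  filter_upwards [eventually_mem_resolventDisk a b, self_mem_nhdsWithin] with z hz h0
  rw [h.weylRaw_eq ha hC hz h0, inv_mul_cancel_left₀ (pow_ne_zero _ h0)]

theorem weylNormalized_zero (h : Admissible a b) (ha : ∀ n, a n ≠ 0) {C : ℝ}
    (hC : ∀ n, |∏ j ∈ Finset.range n, a j| ≤ C) (k : ℕ) :
    weylNormalized a b k 0 = ((∏ j ∈ Finset.range k, a j : ℝ) : ℂ) := by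
  rw [weylNormalized, extendZero, Function.update_self]
  exact (h.tendsto_weylRaw_normalized ha hC k).limUnder_eq

theorem weylNormalized_eq (h : Admissible a b) (ha : ∀ n, a n ≠ 0) {C : ℝ}
    (hC : ∀ n, |∏ j ∈ Finset.range n, a j| ≤ C) {z : ℂ} (hz : z ∈ resolventDisk a b) (k : ℕ) :
    weylNormalized a b k z = ((∏ j ∈ Finset.range k, a j : ℝ) : ℂ) *
      (renDet (_root_.strip (k + 1) a) (_root_.strip (k + 1) b) z / renDet a b z) := by
  rcases eq_or_ne z 0 with rfl | h0
  · rw [h.weylNormalized_zero ha hC, renDet_zero, renDet_zero, div_one, mul_one]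
  · rw [weylNormalized, extendZero, Function.update_of_ne h0, h.weylRaw_eq ha hC hz h0,
      inv_mul_cancel_left₀ (pow_ne_zero _ h0)]

theorem tendsto_weylRaw_zero (h : Admissible a b) (ha : ∀ n, a n ≠ 0) {C : ℝ}
    (hC : ∀ n, |∏ j ∈ Finset.range n, a j| ≤ C) :
    Tendsto (weylRaw a b 0) (𝓝[≠] 0) (𝓝 0) := by
  have h1 : Tendsto (fun z : ℂ => z) (𝓝[≠] 0) (𝓝 0) := tendsto_id.mono_left nhdsWithin_le_nhds
  have h2 := h1.mul (h.tendsto_renDet_ratio 1)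
  rw [zero_mul] at h2
  refine h2.congr' ?_
  filter_upwards [eventually_mem_resolventDisk a b, self_mem_nhdsWithin] with z hz h0
  rw [h.weylRaw_eq ha hC hz h0]
  simp

theorem weylM_zero (h : Admissible a b) (ha : ∀ n, a n ≠ 0) {C : ℝ}
    (hC : ∀ n, |∏ j ∈ Finset.range n, a j| ≤ C) : weylM a b 0 = 0 := by
  rw [weylM, extendZero, Function.update_self]
  exact (h.tendsto_weylRaw_zero ha hC).limUnder_eq

theorem weylM_eq (h : Admissible a b) (ha : ∀ n, a n ≠ 0) {C : ℝ}
    (hC : ∀ n, |∏ j ∈ Finset.range n, a j| ≤ C) {z : ℂ} (hz : z ∈ resolventDisk a b) :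
    weylM a b z = z * renDet (_root_.strip 1 a) (_root_.strip 1 b) z / renDet a b z := by
  rcases eq_or_ne z 0 with rfl | h0
  · rw [h.weylM_zero ha hC, zero_mul, zero_div]
  · rw [weylM, extendZero, Function.update_of_ne h0, h.weylRaw_eq ha hC hz h0]
    simp [mul_div_assoc]

theorem tendstoUniformlyOn_weylNormalized (h : Admissible a b) (ha : ∀ n, a n ≠ 0) {P : ℝ}
    (hP : Tendsto (fun n => ∏ j ∈ Finset.range n, a j) atTop (𝓝 P)) {K : Set ℂ}
    (hK : K ⊆ resolventDisk a b) (hKc : IsCompact K) :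
    TendstoUniformlyOn (weylNormalized a b) (fun z => ((P : ℂ)⁻¹ * renDet a b z)⁻¹) atTop K := by
  obtain ⟨C, hC⟩ := (Metric.isBounded_range_of_tendsto _ hP).exists_norm_le
  replace hC : ∀ n, |∏ j ∈ Finset.range n, a j| ≤ C := fun n => hC _ ⟨n, rfl⟩
  have hball : K ⊆ Metric.ball 0 1 := fun z hz => mem_ball_zero_iff.2 (hK hz).1
  -- Compactness is used twice: to stay inside a disk of radius `r < 1`, where `L_n → 1` uniformly,
  -- and below to bound the inverse of `L_ren` on `K`.
  obtain ⟨r, hr, hKr⟩ : ∃ r < 1, K ⊆ Metric.closedBall (0 : ℂ) r := by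
    rcases K.eq_empty_or_nonempty with rfl | hne
    · exact ⟨0, one_pos, Set.empty_subset _⟩
    · obtain ⟨w, hw, hmax⟩ := hKc.exists_isMaxOn hne continuous_norm.continuousOn
      exact ⟨‖w‖, (hK hw).1, fun z hz => mem_closedBall_zero_iff.2 (hmax hz)⟩
  obtain ⟨M, hM⟩ := hKc.exists_bound_of_continuousOn
    ((h.continuousOn_renDet.mono hball).inv₀ fun z hz => h.renDet_ne_zero ha hC (hK hz))
  have h1 : Tendsto (fun p : ℕ × ℂ => renDet (_root_.strip (p.1 + 1) a) (_root_.strip (p.1 + 1) b) p.2)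
      (atTop ×ˢ 𝓟 K) (𝓝 1) := by
    have := (h.tendsto_renDet_strip hr).comp
      ((tendsto_add_atTop_nat 1).prodMap (tendsto_id.mono_right (principal_mono.2 hKr)))
    simpa only [Function.comp_def, Prod.map_fst, Prod.map_snd, id] using this
  have h2 : Tendsto (fun p : ℕ × ℂ => ((∏ j ∈ Finset.range p.1, a j : ℝ) : ℂ))
      (atTop ×ˢ 𝓟 K) (𝓝 (P : ℂ)) :=
    ((Complex.continuous_ofReal.tendsto P).comp hP).comp tendsto_fst
  have h3 := (h2.mul h1).sub_const (P : ℂ)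
  rw [mul_one, sub_self] at h3
  have hmem : ∀ᶠ p : ℕ × ℂ in atTop ×ˢ 𝓟 K, p.2 ∈ K :=
    (eventually_principal.2 fun _ h => h).prod_inr _
  have hb : IsBoundedUnder (· ≤ ·) (atTop ×ˢ 𝓟 K) (norm ∘ fun p : ℕ × ℂ => (renDet a b p.2)⁻¹) :=
    isBoundedUnder_of_eventually_le (a := M) (hmem.mono fun p hp => hM _ hp)
  have h4 := h3.zero_mul_isBoundedUnder_le hb
  rw [Metric.tendstoUniformlyOn_iff]
  intro ε hε
  have h5 := Metric.tendsto_nhds.1 h4 ε hε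
  rw [eventually_prod_principal_iff] at h5
  filter_upwards [h5] with n hn z hz
  have := hn z hz
  rw [dist_zero_right] at this
  rw [dist_comm, dist_eq_norm, h.weylNormalized_eq ha hC (hK hz), mul_inv, inv_inv]
  rwa [div_eq_mul_inv, ← mul_assoc, ← sub_mul]

end Admissible

theorem theorem6p6 (a b : ℕ → ℝ) (ha : ∀ n, 0 < a n)
    (hα : Summable fun n => |a n - 1| ^ 2 + |b n| ^ 2)
    (P : ℝ) (hP : P ≠ 0)
    (hβ : Tendsto (fun n => ∏ j ∈ Finset.range n, a j) atTop (𝓝 P))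
    (hγ : ∃ s : ℝ, Tendsto (fun n => ∑ j ∈ Finset.range n, b j) atTop (𝓝 s)) :
    -- the ingredients of the renormalized determinant are well defined on the unit disk
    (∀ z : ℂ, ‖z‖ < 1 →
      IsHilbertSchmidt (perturbOp a b z) ∧
      IsTraceClass (regPart (perturbOp a b z)) ∧
      Tendsto (sectionDet (regPart (perturbOp a b z))) atTop (𝓝 (detTwo (perturbOp a b z))) ∧
      Tendsto (traceSum a b z) atTop (𝓝 (renTrace a b z))) ∧
    -- the singularities at `z = 0` of `M` and of `z^{-n} w_n` are removable
    Tendsto (weylRaw a b 0) (𝓝[≠] 0) (𝓝 (weylM a b 0)) ∧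
    (∀ k, Tendsto (fun z => (z ^ (k + 1))⁻¹ * weylRaw a b k z) (𝓝[≠] 0)
      (𝓝 (weylNormalized a b k 0))) ∧
    -- the renormalized determinant has no zeros off the spectrum
    (∀ z ∈ resolventDisk a b, renDet a b z ≠ 0) ∧
    -- the formula for the `M`-function
    (∀ z ∈ resolventDisk a b,
      weylM a b z = z * renDet (strip 1 a) (strip 1 b) z / renDet a b z) ∧
    -- the formula for the Weyl solution, with `n = k + 1`
    (∀ k, ∀ z ∈ resolventDisk a b,
      weylNormalized a b k z =
        ((∏ j ∈ Finset.range k, a j : ℝ) : ℂ) *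
          (renDet (strip (k + 1) a) (strip (k + 1) b) z / renDet a b z)) ∧
    -- Jost asymptotics, uniformly on compact sets, with `u = P⁻¹ L_ren`
    (∀ K ⊆ resolventDisk a b, IsCompact K →
      TendstoUniformlyOn (weylNormalized a b)
        (fun z => ((P : ℂ)⁻¹ * renDet a b z)⁻¹) atTop K) := by
  have ha' : ∀ n, a n ≠ 0 := fun n => (ha n).ne'
  have hsq : Summable fun n => (a n - 1) ^ 2 :=
    Summable.of_nonneg_of_le (fun _ => by positivity)
      (fun n => by rw [sq_abs, sq_abs]; nlinarith [sq_nonneg (b n)]) hα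
  have h : Admissible a b := ⟨hα, exists_tendsto_sum_sub_one ha hsq hP hβ, hγ⟩
  obtain ⟨C, hC⟩ := (Metric.isBounded_range_of_tendsto _ hβ).exists_norm_le
  replace hC : ∀ n, |∏ j ∈ Finset.range n, a j| ≤ C := fun n => hC _ ⟨n, rfl⟩
  refine ⟨fun z hz => ?_, ?_, fun k => ?_, fun z hz => h.renDet_ne_zero ha' hC hz,
    fun z hz => h.weylM_eq ha' hC hz, fun k z hz => h.weylNormalized_eq ha' hC hz k,
    fun K hK hKc => h.tendstoUniformlyOn_weylNormalized ha' hβ hK hKc⟩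
  · have hA := h.hsBound_perturbOp z
    exact ⟨hA.isHilbertSchmidt, hA.isTraceClass_regPart, hA.tendsto_sectionDet,
      h.tendsto_traceSum hz⟩
  · rw [h.weylM_zero ha' hC]
    exact h.tendsto_weylRaw_zero ha' hC
  · rw [h.weylNormalized_zero ha' hC]
    exact h.tendsto_weylRaw_normalized ha' hC k
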